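/- Let $R$ be a (not necessarily commutative) ring with unit that is right artinian, and let $(C,\Delta,\varepsilon)$ be an $R$-coring, i.e. a coalgebra in the monoidal category of $R$-bimodules. Assume that $C$ satisfies the left $\alpha$-condition: for every right $R$-module $N$ the canonical map $$N\otimes_R C\to \mathrm{Hom}_R({}^*C,N),\qquad n\otimes c\mapsto (f\mapsto n f(c)),\qquad {}^*C={}_R\mathrm{Hom}(C,R),$$ is injective. Let $\mathcal M^C$ be the category of right $C$-comodules. A projective cover of a right comodule $M$ is a projective object $P$ of $\mathcal M^C$ together with an epimorphism $f:P\to M$ that is superfluous, i.e. every subcomodule $L\subseteq P$ with $\ker f+L=P$ equals $P$. A right comodule is finitely generated if it is generated, as a comodule, by a finite subset. Then the following statements are equivalent: (i) $C$ is right semiperfect, i.e. every simple object of $\mathcal M^C$ has a projective cover; (ii) every finitely generated right $C$-comodule has a projective cover; (iii) every finitely generated right $C$-comodule has a projective cover $P\to M$ with $P$ finitely generated; (iv) the category $\mathcal M^C$ has enough projectives; (v) every simple right $C$-comodule has a projective cover $P\to S$ with $P$ finitely generated; (vi) the category $\mathcal M^C$ has a projective generator. -/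

import Mathlib

open CategoryTheory

universe u

/-! ### Tensor products over a noncommutative ring

Right `R`-modules are modules over `Rᵐᵒᵖ`, with `m · r = MulOpposite.op r • m`. An `R`-bimodule is
an additive group with commuting actions of `R` and of `Rᵐᵒᵖ`. -/

section BalTensor

open scoped TensorProduct

/-- The tensor product `M ⊗_R N` of a right `R`-module `M` and a left `R`-module `N`: the quotient
of `M ⊗_ℤ N` by the subgroup generated by all `m r ⊗ n - m ⊗ r n`. -/
def BalTensor (R M N : Type u) [Ring R] [AddCommGroup M] [Module Rᵐᵒᵖ M] [AddCommGroup N]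
    [Module R N] : Type u :=
  (M ⊗[ℤ] N) ⧸ AddSubgroup.closure
    {t : M ⊗[ℤ] N | ∃ (m : M) (r : R) (n : N),
      t = (MulOpposite.op r • m) ⊗ₜ[ℤ] n - m ⊗ₜ[ℤ] (r • n)}

namespace BalTensor

variable {R : Type u} [Ring R]
variable {M : Type u} [AddCommGroup M] [Module Rᵐᵒᵖ M]
variable {N : Type u} [AddCommGroup N] [Module R N]
variable {M' : Type u} [AddCommGroup M'] [Module Rᵐᵒᵖ M']
variable {N' : Type u} [AddCommGroup N'] [Module R N']
variable {A : Type u} [AddCommGroup A]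

instance instAddCommGroup : AddCommGroup (BalTensor R M N) :=
  inferInstanceAs (AddCommGroup ((M ⊗[ℤ] N) ⧸ AddSubgroup.closure
    {t : M ⊗[ℤ] N | ∃ (m : M) (r : R) (n : N),
      t = (MulOpposite.op r • m) ⊗ₜ[ℤ] n - m ⊗ₜ[ℤ] (r • n)}))

/-- The quotient map `M ⊗_ℤ N → M ⊗_R N`. -/
def mk : M ⊗[ℤ] N →+ BalTensor R M N :=
  QuotientAddGroup.mk' (AddSubgroup.closure
    {t : M ⊗[ℤ] N | ∃ (m : M) (r : R) (n : N),
      t = (MulOpposite.op r • m) ⊗ₜ[ℤ] n - m ⊗ₜ[ℤ] (r • n)})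

variable (R) in
/-- The pure tensor `m ⊗ n` in `M ⊗_R N`. -/
def tmul (m : M) (n : N) : BalTensor R M N := mk (m ⊗ₜ[ℤ] n)

theorem add_tmul (m m' : M) (n : N) : tmul R (m + m') n = tmul R m n + tmul R m' n := by
  simp [tmul, TensorProduct.add_tmul]

theorem tmul_add (m : M) (n n' : N) : tmul R m (n + n') = tmul R m n + tmul R m n' := by
  simp [tmul, TensorProduct.tmul_add]

theorem zero_tmul (n : N) : tmul R (0 : M) n = 0 := by simp [tmul]

theorem tmul_zero (m : M) : tmul R m (0 : N) = 0 := by simp [tmul]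

theorem smul_tmul (m : M) (r : R) (n : N) :
    tmul R (MulOpposite.op r • m) n = tmul R m (r • n) := by
  rw [← sub_eq_zero, tmul, tmul, ← map_sub]
  exact (QuotientAddGroup.eq_zero_iff _).2 (AddSubgroup.subset_closure ⟨m, r, n, rfl⟩)

/-- The additive map out of `M ⊗_R N` induced by a biadditive `R`-balanced map. -/
def lift (f : M →+ N →+ A) (hf : ∀ m (r : R) n, f (MulOpposite.op r • m) n = f m (r • n)) :
    BalTensor R M N →+ A :=
  QuotientAddGroup.lift _ (TensorProduct.liftAddHom f (fun z m n => by simp)) (by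
    rw [AddSubgroup.closure_le]
    rintro _ ⟨m, r, n, rfl⟩
    simp [hf])

@[simp] theorem lift_tmul (f : M →+ N →+ A)
    (hf : ∀ m (r : R) n, f (MulOpposite.op r • m) n = f m (r • n)) (m : M) (n : N) :
    lift f hf (tmul R m n) = f m n := rfl

@[elab_as_elim]
theorem induction {p : BalTensor R M N → Prop} (h0 : p 0) (ht : ∀ m n, p (tmul R m n))
    (ha : ∀ x y, p x → p y → p (x + y)) (x : BalTensor R M N) : p x := by
  obtain ⟨t, rfl⟩ := QuotientAddGroup.mk_surjective x
  induction t using TensorProduct.induction_on with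
  | zero => exact h0
  | tmul m n => exact ht m n
  | add a b iha ihb => exact ha _ _ iha ihb

theorem hom_ext {f g : BalTensor R M N →+ A} (h : ∀ m n, f (tmul R m n) = g (tmul R m n)) :
    f = g := by
  ext x
  induction x using BalTensor.induction with
  | h0 => simp
  | ht m n => exact h m n
  | ha x y hx hy => simp [hx, hy]

/-- The map `f ⊗_R g : M ⊗_R N → M' ⊗_R N'`. -/
def map (f : M →ₗ[Rᵐᵒᵖ] M') (g : N →ₗ[R] N') : BalTensor R M N →+ BalTensor R M' N' :=
  lift (AddMonoidHom.mk' (fun m => AddMonoidHom.mk' (fun n => tmul R (f m) (g n))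
      (fun n n' => by simp [tmul_add]))
    (fun m m' => by ext n; simp [add_tmul]))
    (fun m r n => by simp [smul_tmul])

@[simp] theorem map_tmul (f : M →ₗ[Rᵐᵒᵖ] M') (g : N →ₗ[R] N') (m : M) (n : N) :
    map f g (tmul R m n) = tmul R (f m) (g n) := rfl

/-- Right multiplication by `s` on an `R`-bimodule, as a left `R`-linear map. -/
def rightMul [Module Rᵐᵒᵖ N] [SMulCommClass R Rᵐᵒᵖ N] (s : Rᵐᵒᵖ) : N →ₗ[R] N where
  toFun n := s • n
  map_add' := smul_add s
  map_smul' r n := (smul_comm r s n).symm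

/-- Left multiplication by `s` on an `R`-bimodule, as a right `R`-linear map. -/
def leftMul [Module R M] [SMulCommClass R Rᵐᵒᵖ M] (s : R) : M →ₗ[Rᵐᵒᵖ] M where
  toFun m := s • m
  map_add' := smul_add s
  map_smul' t m := smul_comm s t m

@[simp] theorem rightMul_apply [Module Rᵐᵒᵖ N] [SMulCommClass R Rᵐᵒᵖ N] (s : Rᵐᵒᵖ) (n : N) :
    rightMul (R := R) s n = s • n := rfl

@[simp] theorem leftMul_apply [Module R M] [SMulCommClass R Rᵐᵒᵖ M] (s : R) (m : M) :
    leftMul s m = s • m := rfl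

/-- If `N` is an `R`-bimodule then `M ⊗_R N` is a right `R`-module: `(m ⊗ n) r = m ⊗ n r`. -/
instance instRightModule [Module Rᵐᵒᵖ N] [SMulCommClass R Rᵐᵒᵖ N] :
    Module Rᵐᵒᵖ (BalTensor R M N) where
  smul s x := map LinearMap.id (rightMul (R := R) (N := N) s) x
  one_smul x := DFunLike.congr_fun (f := map LinearMap.id (rightMul (R := R) (N := N) 1))
    (g := AddMonoidHom.id _) (hom_ext fun m n => by simp) x
  mul_smul s t x := DFunLike.congr_fun (f := map LinearMap.id (rightMul (R := R) (N := N) (s * t)))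
    (g := (map LinearMap.id (rightMul (R := R) (N := N) s)).comp
      (map LinearMap.id (rightMul (R := R) (N := N) t)))
    (hom_ext fun m n => by simp [mul_smul]) x
  smul_zero s := map_zero (map LinearMap.id (rightMul (R := R) (N := N) s))
  smul_add s := map_add (map LinearMap.id (rightMul (R := R) (N := N) s))
  add_smul s t x := DFunLike.congr_fun (f := map LinearMap.id (rightMul (R := R) (N := N) (s + t)))
    (g := map LinearMap.id (rightMul (R := R) (N := N) s) +
      map LinearMap.id (rightMul (R := R) (N := N) t))
    (hom_ext fun m n => by simp [add_smul, tmul_add]) x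
  zero_smul x := DFunLike.congr_fun (f := map LinearMap.id (rightMul (R := R) (N := N) 0))
    (g := 0) (hom_ext fun m n => by simp [tmul_zero]) x

@[simp] theorem op_smul_tmul [Module Rᵐᵒᵖ N] [SMulCommClass R Rᵐᵒᵖ N] (s : Rᵐᵒᵖ) (m : M) (n : N) :
    s • tmul R m n = tmul R m (s • n) := rfl

/-- If `M` is an `R`-bimodule then `M ⊗_R N` is a left `R`-module: `r (m ⊗ n) = r m ⊗ n`. -/
instance instLeftModule [Module R M] [SMulCommClass R Rᵐᵒᵖ M] :
    Module R (BalTensor R M N) where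
  smul s x := map (leftMul s) LinearMap.id x
  one_smul x := DFunLike.congr_fun
    (f := map (leftMul 1) LinearMap.id)
    (g := AddMonoidHom.id _) (hom_ext fun m n => by simp) x
  mul_smul s t x := DFunLike.congr_fun
    (f := map (leftMul (s * t)) LinearMap.id)
    (g := (map (leftMul s) LinearMap.id).comp
      (map (leftMul t) LinearMap.id))
    (hom_ext fun m n => by simp [mul_smul]) x
  smul_zero s := map_zero
    (map (leftMul s) LinearMap.id)
  smul_add s := map_add
    (map (leftMul s) LinearMap.id)
  add_smul s t x := DFunLike.congr_fun
    (f := map (leftMul (s + t)) LinearMap.id)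
    (g := map (leftMul s) LinearMap.id +
      map (leftMul t) LinearMap.id)
    (hom_ext fun m n => by simp [add_smul, add_tmul]) x
  zero_smul x := DFunLike.congr_fun
    (f := map (leftMul 0) LinearMap.id)
    (g := 0) (hom_ext fun m n => by simp [zero_tmul]) x

@[simp] theorem left_smul_tmul [Module R M] [SMulCommClass R Rᵐᵒᵖ M] (s : R) (m : M) (n : N) :
    s • tmul R m n = tmul R (s • m) n := rfl

/-- The biadditive map `(m ⊗ p, n) ↦ m ⊗ (p ⊗ n)`. -/
def assocAux {P : Type u} [AddCommGroup P] [Module R P] [Module Rᵐᵒᵖ P] [SMulCommClass R Rᵐᵒᵖ P] :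
    BalTensor R M P →+ N →+ BalTensor R M (BalTensor R P N) :=
  lift (AddMonoidHom.mk' (fun m => AddMonoidHom.mk' (fun p => AddMonoidHom.mk'
        (fun n => tmul R m (tmul R p n))
        (fun n n' => by rw [tmul_add, tmul_add]))
        (fun p p' => AddMonoidHom.ext fun n => by
          change tmul R m (tmul R (p + p') n) = tmul R m (tmul R p n) + tmul R m (tmul R p' n)
          rw [add_tmul, tmul_add]))
        (fun m m' => AddMonoidHom.ext fun p => AddMonoidHom.ext fun n => by
          exact add_tmul m m' (tmul R p n)))
      (fun m r p => AddMonoidHom.ext fun n => by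
        change tmul R (MulOpposite.op r • m) (tmul R p n) = tmul R m (tmul R (r • p) n)
        rw [smul_tmul, left_smul_tmul])

theorem assocAux_tmul {P : Type u} [AddCommGroup P] [Module R P] [Module Rᵐᵒᵖ P]
    [SMulCommClass R Rᵐᵒᵖ P] (m : M) (p : P) (n : N) :
    assocAux (tmul R m p) n = tmul R m (tmul R p n) := rfl

theorem assocAux_balanced {P : Type u} [AddCommGroup P] [Module R P] [Module Rᵐᵒᵖ P]
    [SMulCommClass R Rᵐᵒᵖ P] (x : BalTensor R M P) (r : R) (n : N) :
    assocAux (MulOpposite.op r • x) n = assocAux x (r • n) := by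
  induction x using BalTensor.induction with
  | h0 => rw [smul_zero, map_zero, AddMonoidHom.zero_apply, AddMonoidHom.zero_apply]
  | ht m p => rw [op_smul_tmul, assocAux_tmul, assocAux_tmul, smul_tmul]
  | ha x y hx hy =>
    rw [smul_add, map_add, map_add, AddMonoidHom.add_apply, AddMonoidHom.add_apply, hx, hy]

/-- The canonical map `(M ⊗_R P) ⊗_R N → M ⊗_R (P ⊗_R N)`, `(m ⊗ p) ⊗ n ↦ m ⊗ (p ⊗ n)`, for an
`R`-bimodule `P`. -/
def assoc {P : Type u} [AddCommGroup P] [Module R P] [Module Rᵐᵒᵖ P] [SMulCommClass R Rᵐᵒᵖ P] :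
    BalTensor R (BalTensor R M P) N →+ BalTensor R M (BalTensor R P N) :=
  lift assocAux assocAux_balanced

@[simp] theorem assoc_tmul {P : Type u} [AddCommGroup P] [Module R P] [Module Rᵐᵒᵖ P]
    [SMulCommClass R Rᵐᵒᵖ P] (m : M) (p : P) (n : N) :
    assoc (tmul R (tmul R m p) n) = tmul R m (tmul R p n) := rfl

/-- The canonical map `M ⊗_R R → M`, `m ⊗ r ↦ m r`. -/
def rid : BalTensor R M R →+ M :=
  lift (AddMonoidHom.mk' (fun m => AddMonoidHom.mk' (fun r : R => MulOpposite.op r • m)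
      (fun r s => by simp [add_smul]))
    (fun m m' => by ext r; simp))
    (fun m r s => by simp [smul_smul])

@[simp] theorem rid_tmul (m : M) (r : R) : rid (tmul R m r) = MulOpposite.op r • m := rfl

/-- The canonical map `R ⊗_R N → N`, `r ⊗ n ↦ r n`. -/
def lid : BalTensor R R N →+ N :=
  lift (AddMonoidHom.mk' (fun r : R => AddMonoidHom.mk' (fun n => r • n)
      (fun n n' => by simp))
    (fun r s => by ext n; simp [add_smul]))
    (fun r s n => by simp [smul_smul])

@[simp] theorem lid_tmul (r : R) (n : N) : lid (tmul R r n) = r • n := rfl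

end BalTensor

end BalTensor

/-! ### The left α-condition -/

/-- The canonical map `α_{N,M} : N ⊗_R M → Hom_R(*M, N)`, `α(n ⊗ m)(f) = n f(m)`, for a left
`R`-module `M` and a right `R`-module `N`. Here `*M = Hom_R(M, R)`, which is a right `R`-module by
`(f r)(m) = f(m) r`. -/
def alphaMap (R N M : Type u) [Ring R] [AddCommGroup N] [Module Rᵐᵒᵖ N] [AddCommGroup M]
    [Module R M] : BalTensor R N M →+ ((M →ₗ[R] R) →ₗ[Rᵐᵒᵖ] N) :=
  BalTensor.lift
    (AddMonoidHom.mk' (fun n => AddMonoidHom.mk' (fun m =>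
        { toFun := fun f => MulOpposite.op (f m) • n
          map_add' := fun f g => by simp [add_smul]
          map_smul' := fun r f => by simp [mul_smul] })
        (fun m m' => by ext f; simp [add_smul]))
      (fun n n' => by ext m f; simp))
    (fun n r m => by ext f; simp [mul_smul])

/-- A left `R`-module `M` satisfies the left α-condition if `α_{N,M}` is injective for every right
`R`-module `N`. -/
def LeftAlphaCondition (R M : Type u) [Ring R] [AddCommGroup M] [Module R M] : Prop :=
  ∀ (N : Type u) [AddCommGroup N] [Module Rᵐᵒᵖ N], Function.Injective (alphaMap R N M)

/-! ### Corings and comodules -/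

/-- An `R`-coring: an `R`-bimodule `C` with bimodule maps `Δ : C → C ⊗_R C` and `ε : C → R`
that are coassociative and counital. -/
class Coring (R C : Type u) [Ring R] [AddCommGroup C] [Module R C] [Module Rᵐᵒᵖ C]
    [SMulCommClass R Rᵐᵒᵖ C] where
  /-- The comultiplication `Δ`, as a left `R`-linear map. -/
  comul : C →ₗ[R] BalTensor R C C
  /-- `Δ` is right `R`-linear. -/
  comul_op_smul : ∀ (s : Rᵐᵒᵖ) (c : C), comul (s • c) = s • comul c
  /-- The counit `ε`, as a left `R`-linear map. -/
  counit : C →ₗ[R] R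
  /-- `ε` is right `R`-linear. -/
  counit_op_smul : ∀ (s : Rᵐᵒᵖ) (c : C), counit (s • c) = s • counit c
  /-- `(Δ ⊗ C) ∘ Δ = (C ⊗ Δ) ∘ Δ`. -/
  coassoc : ∀ c : C,
    BalTensor.assoc (BalTensor.map
        { toFun := comul, map_add' := map_add comul, map_smul' := comul_op_smul }
        LinearMap.id (comul c)) =
      BalTensor.map LinearMap.id comul (comul c)
  /-- `(ε ⊗ C) ∘ Δ = C`. -/
  counit_left : ∀ c : C,
    BalTensor.lid (BalTensor.map
        { toFun := counit, map_add' := map_add counit, map_smul' := counit_op_smul }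
        LinearMap.id (comul c)) = c
  /-- `(C ⊗ ε) ∘ Δ = C`. -/
  counit_right : ∀ c : C,
    BalTensor.rid (BalTensor.map LinearMap.id counit (comul c)) = c

section Comodules

variable (R C : Type u) [Ring R] [AddCommGroup C] [Module R C] [Module Rᵐᵒᵖ C]
  [SMulCommClass R Rᵐᵒᵖ C] [Coring R C]

/-- A right `C`-comodule: a right `R`-module `M` with a right `R`-linear coaction
`ρ : M → M ⊗_R C` such that `(ρ ⊗ C) ∘ ρ = (M ⊗ Δ) ∘ ρ` and `(M ⊗ ε) ∘ ρ = M`. -/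
structure RightComodule where
  /-- The underlying right `R`-module. -/
  carrier : Type u
  [addCommGroup : AddCommGroup carrier]
  [module : Module Rᵐᵒᵖ carrier]
  /-- The coaction. -/
  coact : carrier →ₗ[Rᵐᵒᵖ] BalTensor R carrier C
  coassoc : ∀ m : carrier,
    BalTensor.assoc (BalTensor.map coact LinearMap.id (coact m)) =
      BalTensor.map LinearMap.id (Coring.comul (R := R) (C := C)) (coact m)
  counit : ∀ m : carrier,
    BalTensor.rid (BalTensor.map LinearMap.id (Coring.counit (R := R) (C := C)) (coact m)) = m

attribute [instance] RightComodule.addCommGroup RightComodule.module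

namespace RightComodule

variable {R C}

/-- A morphism of right `C`-comodules: a right `R`-linear map compatible with the coactions. -/
@[ext]
structure Hom (M N : RightComodule R C) where
  /-- The underlying right `R`-linear map. -/
  toLin : M.carrier →ₗ[Rᵐᵒᵖ] N.carrier
  colinear : ∀ m : M.carrier,
    N.coact (toLin m) = BalTensor.map toLin LinearMap.id (M.coact m)

/-- The category of right `C`-comodules. -/
instance : Category (RightComodule R C) where
  Hom M N := Hom M N
  id M := ⟨LinearMap.id, fun m => DFunLike.congr_fun (f := AddMonoidHom.id _)
    (g := BalTensor.map LinearMap.id LinearMap.id) (BalTensor.hom_ext fun _ _ => rfl) (M.coact m)⟩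
  comp {M N P} f g := ⟨g.toLin ∘ₗ f.toLin, fun m => by
    rw [LinearMap.comp_apply, g.colinear, f.colinear]
    exact DFunLike.congr_fun (f := (BalTensor.map g.toLin LinearMap.id).comp
        (BalTensor.map f.toLin LinearMap.id))
      (g := BalTensor.map (g.toLin ∘ₗ f.toLin) LinearMap.id)
      (BalTensor.hom_ext fun _ _ => rfl) (M.coact m)⟩

instance : Limits.HasZeroMorphisms (RightComodule R C) where
  zero M N := ⟨⟨0, fun m => by
    rw [LinearMap.zero_apply, map_zero]
    exact DFunLike.congr_fun (f := 0) (g := BalTensor.map 0 LinearMap.id)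
      (BalTensor.hom_ext fun _ _ => (BalTensor.zero_tmul _).symm) (M.coact m)⟩⟩
  comp_zero _ _ := rfl
  zero_comp _ _ _ f := Hom.ext (LinearMap.ext fun _ => map_zero f.toLin)

/-- A right `R`-submodule `L` of `M` is a subcomodule if `ρ(L)` lies in the image of `L ⊗_R C` in
`M ⊗_R C`. (Under the left α-condition `C` is flat as a left `R`-module, so that this image is
`L ⊗_R C` and `L` is itself a comodule.) -/
def IsSubcomodule (M : RightComodule R C) (L : Submodule Rᵐᵒᵖ M.carrier) : Prop :=
  ∀ x ∈ L, M.coact x ∈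
    (BalTensor.map L.subtype (LinearMap.id : C →ₗ[R] C)).range

/-- `M` is finitely generated as a comodule: some finite subset of `M` is contained in no
subcomodule other than `M`. -/
def FinitelyGenerated (M : RightComodule R C) : Prop :=
  ∃ s : Finset M.carrier, ∀ L : Submodule Rᵐᵒᵖ M.carrier, M.IsSubcomodule L →
    (s : Set M.carrier) ⊆ L → L = ⊤

/-- `f : P ⟶ M` is a projective cover of `M`: `P` is a projective object and `f` is a superfluous
epimorphism, which means that a subcomodule `L` of `P` with `Ker f + L = P` is equal to `P`. -/
structure IsProjectiveCover {P M : RightComodule R C} (f : P ⟶ M) : Prop where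
  projective : Projective P
  epi : Epi f
  superfluous : ∀ L : Submodule Rᵐᵒᵖ P.carrier, P.IsSubcomodule L →
    LinearMap.ker (Hom.toLin f) ⊔ L = ⊤ → L = ⊤

/-- `M` has a projective cover. -/
def HasProjectiveCover (M : RightComodule R C) : Prop :=
  ∃ (P : RightComodule R C) (f : P ⟶ M), IsProjectiveCover f

/-- `M` has a projective cover that is finitely generated. -/
def HasFGProjectiveCover (M : RightComodule R C) : Prop :=
  ∃ (P : RightComodule R C) (f : P ⟶ M), IsProjectiveCover f ∧ P.FinitelyGenerated

end RightComodule

/-- `C` (assumed to satisfy the left α-condition) is right semiperfect if every simple object of the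
category of right `C`-comodules has a projective cover. -/
def Coring.IsRightSemiperfect : Prop :=
  ∀ S : RightComodule R C, Simple S → S.HasProjectiveCover

end Comodules

/-!
Under the left α-condition a right comodule `M` is governed by the right action `m · f = m₀ f(m₁)`
of the left dual `*C`: a submodule of `M` is a subcomodule exactly when it is stable under this
action (`RightComodule.isSubcomodule_iff`). Since `m · *C` lies in the `R`-span of the finitely many
left tensor factors of `ρ(m)` and `R` is right noetherian by Hopkins–Levitzki, every comodule is the
union of subcomodules of finite length over `R` (`RightComodule.exists_fg_isSubcomodule`). The
α-condition also makes `C` flat, so subcomodules are comodules, and monomorphisms and epimorphisms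
are the injective and the surjective morphisms. Coproducts are direct sums.

The equivalences come down to producing projective comodules of finite length.

* Enough projectives give finitely generated projective covers of simple comodules `S`. Let `P ⟶ S`
  be a nonzero morphism with `P` projective. As `P` is a summand of a direct sum of comodules of
  finite length, some endomorphism `u` of `P` with image of finite length has `u ≫ f ≠ 0`
  (`RightComodule.exists_finite_range_comp_ne_zero`). Lifting `f` through the epimorphism `u ≫ f`
  gives an endomorphism `e` with image of finite length and `e ≫ f = f`, and Fitting's lemma cuts
  out of `P` a summand of finite length that still maps onto `S`
  (`RightComodule.exists_projective_range_le`).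
* A quotient `M` of a projective comodule of finite length has a projective cover, namely any
  projective epimorphism `f : P ⟶ M` of minimal length: if `ker f + L = P`, then lifting `f` through
  `L` and applying the same lemma gives a summand of `P` inside `L` that maps onto `M`
  (`RightComodule.hasFGProjectiveCover_of_surjective`).
* If the simple comodules have finitely generated projective covers, then a maximal image of a
  finitely generated projective comodule in a finitely generated `M` is all of `M`
  (`RightComodule.exists_finite_projective_surjective`), and direct sums give enough projectives.
* A projective generator exists because the cyclic comodules `m · *C ≅ *C / ann(m)` form a small
  separating family (`RightComodule.exists_projective_isSeparator`).
-/

/-! ### Exactness properties of the balanced tensor product -/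

namespace BalTensor

variable {R : Type u} [Ring R]
variable {M M' M'' : Type u} [AddCommGroup M] [Module Rᵐᵒᵖ M] [AddCommGroup M'] [Module Rᵐᵒᵖ M']
  [AddCommGroup M''] [Module Rᵐᵒᵖ M'']
variable {N N' N'' : Type u} [AddCommGroup N] [Module R N] [AddCommGroup N'] [Module R N']
  [AddCommGroup N''] [Module R N'']

theorem map_map (f : M →ₗ[Rᵐᵒᵖ] M') (f' : M' →ₗ[Rᵐᵒᵖ] M'') (g : N →ₗ[R] N') (g' : N' →ₗ[R] N'')
    (x : BalTensor R M N) : map f' g' (map f g x) = map (f' ∘ₗ f) (g' ∘ₗ g) x :=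
  DFunLike.congr_fun (f := (map f' g').comp (map f g)) (g := map (f' ∘ₗ f) (g' ∘ₗ g))
    (hom_ext fun _ _ => rfl) x

theorem map_id_id (x : BalTensor R M N) : map LinearMap.id LinearMap.id x = x :=
  DFunLike.congr_fun (f := map LinearMap.id LinearMap.id) (g := AddMonoidHom.id _)
    (hom_ext fun _ _ => rfl) x

/-- Right exactness of `- ⊗_R N`: the kernel of `M ⊗_R N → M/L ⊗_R N` is the image of
`L ⊗_R N`. -/
theorem mem_range_of_map_mkQ_eq_zero (L : Submodule Rᵐᵒᵖ M) {x : BalTensor R M N}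
    (hx : map L.mkQ LinearMap.id x = 0) :
    x ∈ (map L.subtype (LinearMap.id : N →ₗ[R] N)).range := by
  let I := (map L.subtype (LinearMap.id : N →ₗ[R] N)).range
  let φ : M →+ N →+ BalTensor R M N ⧸ I := AddMonoidHom.mk' (fun m => AddMonoidHom.mk'
      (fun n => QuotientAddGroup.mk' I (tmul R m n)) (fun n n' => by rw [tmul_add, map_add]))
    (fun m m' => AddMonoidHom.ext fun n => by
      change QuotientAddGroup.mk' I (tmul R (m + m') n) = _
      rw [add_tmul, map_add]; rfl)
  let ψ : M ⧸ L →+ N →+ BalTensor R M N ⧸ I :=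
    QuotientAddGroup.lift L.toAddSubgroup φ (fun m hm => AddMonoidHom.ext fun n =>
      (QuotientAddGroup.eq_zero_iff _).2 ⟨tmul R ⟨m, hm⟩ n, rfl⟩)
  -- A one-sided inverse of `(M ⊗ N) / I → M/L ⊗ N`.
  let θ : BalTensor R (M ⧸ L) N →+ BalTensor R M N ⧸ I := lift ψ (by
    intro q r n
    obtain ⟨m, rfl⟩ := L.mkQ_surjective q
    change QuotientAddGroup.mk' I (tmul R (MulOpposite.op r • m) n) =
      QuotientAddGroup.mk' I (tmul R m (r • n))
    rw [smul_tmul])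
  have h : θ.comp (map L.mkQ LinearMap.id) = QuotientAddGroup.mk' I := hom_ext fun _ _ => rfl
  refine (QuotientAddGroup.eq_zero_iff x).1 ?_
  have := DFunLike.congr_fun h x
  rw [AddMonoidHom.comp_apply, hx, map_zero] at this
  exact this.symm

section Assoc

variable {P : Type u} [AddCommGroup P] [Module R P] [Module Rᵐᵒᵖ P] [SMulCommClass R Rᵐᵒᵖ P]

/-- For fixed `m`, the map `P ⊗_R N → (M ⊗_R P) ⊗_R N`, `p ⊗ n ↦ (m ⊗ p) ⊗ n`. -/
def assocInvAux (m : M) : BalTensor R P N →+ BalTensor R (BalTensor R M P) N :=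
  lift (AddMonoidHom.mk' (fun p => AddMonoidHom.mk' (fun n => tmul R (tmul R m p) n)
      (fun n n' => by rw [tmul_add]))
    (fun p p' => AddMonoidHom.ext fun n => by
      change tmul R (tmul R m (p + p')) n = tmul R (tmul R m p) n + tmul R (tmul R m p') n
      rw [tmul_add, add_tmul]))
    (fun p r n => by
      change tmul R (tmul R m (MulOpposite.op r • p)) n = tmul R (tmul R m p) (r • n)
      rw [← op_smul_tmul, smul_tmul])

/-- The inverse `M ⊗_R (P ⊗_R N) → (M ⊗_R P) ⊗_R N` of the associativity map. -/
def assocInv : BalTensor R M (BalTensor R P N) →+ BalTensor R (BalTensor R M P) N :=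
  lift (AddMonoidHom.mk' assocInvAux (fun m m' => hom_ext fun p n => by
      change tmul R (tmul R (m + m') p) n = tmul R (tmul R m p) n + tmul R (tmul R m' p) n
      rw [add_tmul, add_tmul]))
    (fun m r x => by
      change assocInvAux (MulOpposite.op r • m) x = assocInvAux m (r • x)
      induction x using BalTensor.induction with
      | h0 => rw [smul_zero, map_zero, map_zero]
      | ht p n =>
        change tmul R (tmul R (MulOpposite.op r • m) p) n = tmul R (tmul R m (r • p)) n
        rw [smul_tmul]
      | ha x y hx hy => rw [smul_add, map_add, map_add, hx, hy])

theorem assocInv_assoc (x : BalTensor R (BalTensor R M P) N) : assocInv (assoc x) = x := by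
  induction x using BalTensor.induction with
  | h0 => rw [map_zero, map_zero]
  | ht y n =>
    induction y using BalTensor.induction with
    | h0 => rw [zero_tmul, map_zero, map_zero]
    | ht m p => rfl
    | ha x y hx hy => rw [add_tmul, map_add, map_add, hx, hy]
  | ha x y hx hy => rw [map_add, map_add, hx, hy]

theorem assoc_assocInv (x : BalTensor R M (BalTensor R P N)) : assoc (assocInv x) = x := by
  induction x using BalTensor.induction with
  | h0 => rw [map_zero, map_zero]
  | ht m y =>
    induction y using BalTensor.induction with
    | h0 => rw [tmul_zero, map_zero, map_zero]
    | ht p n => rfl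
    | ha x y hx hy => rw [tmul_add, map_add, map_add, hx, hy]
  | ha x y hx hy => rw [map_add, map_add, hx, hy]

variable (P) in
/-- The map `f ⊗_R P : M ⊗_R P → M' ⊗_R P` for a bimodule `P`, as a right `R`-linear map. -/
def rTensor (f : M →ₗ[Rᵐᵒᵖ] M') : BalTensor R M P →ₗ[Rᵐᵒᵖ] BalTensor R M' P where
  toFun := map f LinearMap.id
  map_add' := map_add _
  map_smul' s x := by
    induction x using BalTensor.induction with
    | h0 => simp only [smul_zero, map_zero]
    | ht m p => rfl
    | ha x y hx hy => simp only [smul_add, map_add, hx, hy]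

@[simp] theorem rTensor_apply (f : M →ₗ[Rᵐᵒᵖ] M') (x : BalTensor R M P) :
    rTensor P f x = map f LinearMap.id x := rfl

theorem assoc_naturality (f : M →ₗ[Rᵐᵒᵖ] M') (x : BalTensor R (BalTensor R M P) N) :
    assoc (map (rTensor P f) LinearMap.id x) = map f LinearMap.id (assoc x) := by
  induction x using BalTensor.induction with
  | h0 => simp only [map_zero]
  | ht y n =>
    induction y using BalTensor.induction with
    | h0 => rw [zero_tmul]; simp only [map_zero]
    | ht m p => rfl
    | ha x y hx hy => rw [add_tmul]; simp only [map_add, hx, hy]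
  | ha x y hx hy => simp only [map_add, hx, hy]

end Assoc

theorem rid_naturality (f : M →ₗ[Rᵐᵒᵖ] M') (x : BalTensor R M R) :
    rid (map f LinearMap.id x) = f (rid x) := by
  induction x using BalTensor.induction with
  | h0 => simp only [map_zero]
  | ht m r => exact (map_smul f (MulOpposite.op r) m).symm
  | ha x y hx hy => simp only [map_add, hx, hy]

end BalTensor

section Alpha

variable {R : Type u} [Ring R] {M N N' : Type u} [AddCommGroup M] [Module R M]
  [AddCommGroup N] [Module Rᵐᵒᵖ N] [AddCommGroup N'] [Module Rᵐᵒᵖ N']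

theorem alphaMap_tmul (n : N) (m : M) (f : M →ₗ[R] R) :
    alphaMap R N M (BalTensor.tmul R n m) f = MulOpposite.op (f m) • n := rfl

theorem alphaMap_naturality (φ : N →ₗ[Rᵐᵒᵖ] N') (x : BalTensor R N M) (f : M →ₗ[R] R) :
    alphaMap R N' M (BalTensor.map φ LinearMap.id x) f = φ (alphaMap R N M x f) := by
  induction x using BalTensor.induction with
  | h0 => simp only [map_zero, LinearMap.zero_apply]
  | ht n m => exact (map_smul φ _ n).symm
  | ha x y hx hy => simp only [map_add, LinearMap.add_apply, hx, hy]

/-- A module satisfying the left α-condition is flat. -/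
theorem LeftAlphaCondition.map_injective (hM : LeftAlphaCondition R M) {φ : N →ₗ[Rᵐᵒᵖ] N'}
    (hφ : Function.Injective φ) :
    Function.Injective (BalTensor.map φ (LinearMap.id : M →ₗ[R] M)) := by
  intro x y h
  refine hM N (LinearMap.ext fun f => hφ ?_)
  rw [← alphaMap_naturality, h, alphaMap_naturality]

/-- Under the left α-condition, membership in the image of `L ⊗_R M` in `N ⊗_R M` is detected by the
functionals on `M`. -/
theorem LeftAlphaCondition.mem_range_map_subtype_iff (hM : LeftAlphaCondition R M)
    (L : Submodule Rᵐᵒᵖ N) (x : BalTensor R N M) :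
    x ∈ (BalTensor.map L.subtype (LinearMap.id : M →ₗ[R] M)).range ↔
      ∀ f, alphaMap R N M x f ∈ L := by
  constructor
  · rintro ⟨y, rfl⟩ f
    rw [alphaMap_naturality]
    exact (alphaMap R L M y f).2
  · intro h
    refine BalTensor.mem_range_of_map_mkQ_eq_zero L (hM (N ⧸ L) (LinearMap.ext fun f => ?_))
    rw [alphaMap_naturality, map_zero, LinearMap.zero_apply]
    exact (Submodule.Quotient.mk_eq_zero L).2 (h f)

/-- The values `α(x)(f)` all lie in a finitely generated submodule depending only on `x`. -/
theorem exists_fg_alphaMap_mem (x : BalTensor R N M) :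
    ∃ L : Submodule Rᵐᵒᵖ N, L.FG ∧ ∀ f, alphaMap R N M x f ∈ L := by
  induction x using BalTensor.induction with
  | h0 => exact ⟨⊥, Submodule.fg_bot, fun f => by simp⟩
  | ht n m =>
    exact ⟨Submodule.span _ {n}, Submodule.fg_span_singleton n,
      fun f => Submodule.smul_mem _ _ (Submodule.mem_span_singleton_self n)⟩
  | ha x y hx hy =>
    obtain ⟨L, hL, hx⟩ := hx
    obtain ⟨L', hL', hy⟩ := hy
    refine ⟨L ⊔ L', hL.sup hL', fun f => ?_⟩
    rw [map_add, LinearMap.add_apply]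
    exact Submodule.add_mem_sup (hx f) (hy f)

end Alpha

/-! ### The action of the left dual ring and subcomodules -/

section Action

variable {R : Type u} [Ring R] {M P : Type u} [AddCommGroup M] [Module Rᵐᵒᵖ M]
  [AddCommGroup P] [Module R P]

theorem alphaMap_eq_rid (x : BalTensor R M P) (f : P →ₗ[R] R) :
    alphaMap R M P x f = BalTensor.rid (BalTensor.map LinearMap.id f x) := by
  induction x using BalTensor.induction with
  | h0 => simp only [map_zero, LinearMap.zero_apply]
  | ht m p => rfl
  | ha x y hx hy => simp only [map_add, LinearMap.add_apply, hx, hy]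

theorem alphaMap_map_id {P' : Type u} [AddCommGroup P'] [Module R P'] (g : P →ₗ[R] P')
    (x : BalTensor R M P) (f : P' →ₗ[R] R) :
    alphaMap R M P' (BalTensor.map LinearMap.id g x) f = alphaMap R M P x (f ∘ₗ g) := by
  induction x using BalTensor.induction with
  | h0 => simp only [map_zero, LinearMap.zero_apply]
  | ht m p => rfl
  | ha x y hx hy => simp only [map_add, LinearMap.add_apply, hx, hy]

variable {C : Type u} [AddCommGroup C] [Module R C] [Module Rᵐᵒᵖ C] [SMulCommClass R Rᵐᵒᵖ C]

/-- The left `R`-linear map `C ⊗_R C → C`, `c ⊗ d ↦ c f(d)`. Preceded by `Δ` and followed by `g`, it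
gives the product of `*C` under which `(m · f) · g = m · (g(c₁ f(c₂)))`. -/
def convContract (f : C →ₗ[R] R) : BalTensor R C C →ₗ[R] C where
  toFun x := BalTensor.rid (BalTensor.map LinearMap.id f x)
  map_add' x y := by rw [map_add, map_add]
  map_smul' r x := by
    induction x using BalTensor.induction with
    | h0 => simp only [smul_zero, map_zero]
    | ht c d => exact (smul_comm r (MulOpposite.op (f d)) c).symm
    | ha x y hx hy => simp only [smul_add, map_add, hx, hy]

theorem alphaMap_op_smul (x : BalTensor R M C) (c : C) (f g : C →ₗ[R] R) :
    alphaMap R M C (MulOpposite.op (f c) • x) g =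
      alphaMap R M (BalTensor R C C) (BalTensor.assoc (BalTensor.tmul R x c))
        (g ∘ₗ convContract f) := by
  induction x using BalTensor.induction with
  | h0 => rw [BalTensor.zero_tmul]; simp only [smul_zero, map_zero, LinearMap.zero_apply]
  | ht m d => rfl
  | ha x y hx hy =>
    rw [BalTensor.add_tmul]
    simp only [smul_add, map_add, LinearMap.add_apply, hx, hy]

/-- `n ⊗ c ↦ n f(c)` followed by `ρ` and by `n ⊗ c ↦ n g(c)` is `ρ ⊗ C` followed by
`n ⊗ c ⊗ d ↦ n g(c f(d))`. -/
theorem alphaMap_alphaMap (ρ : M →ₗ[Rᵐᵒᵖ] BalTensor R M C) (x : BalTensor R M C)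
    (f g : C →ₗ[R] R) :
    alphaMap R M C (ρ (alphaMap R M C x f)) g =
      alphaMap R M (BalTensor R C C) (BalTensor.assoc (BalTensor.map ρ LinearMap.id x))
        (g ∘ₗ convContract f) := by
  induction x using BalTensor.induction with
  | h0 => simp only [map_zero, LinearMap.zero_apply]
  | ht m c =>
    rw [alphaMap_tmul, map_smul]
    exact alphaMap_op_smul (ρ m) c f g
  | ha x y hx hy => simp only [map_add, LinearMap.add_apply, hx, hy]

end Action

namespace RightComodule

variable {R C : Type u} [Ring R] [AddCommGroup C] [Module R C] [Module Rᵐᵒᵖ C]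
  [SMulCommClass R Rᵐᵒᵖ C] [Coring R C]

theorem hom_ext {M N : RightComodule R C} {f g : M ⟶ N}
    (h : ∀ m, Hom.toLin f m = Hom.toLin g m) : f = g :=
  Hom.ext (LinearMap.ext h)

@[simp] theorem comp_toLin {M N P : RightComodule R C} (f : M ⟶ N) (g : N ⟶ P) :
    Hom.toLin (f ≫ g) = Hom.toLin g ∘ₗ Hom.toLin f := rfl

/-- The right action `m · f = m₀ f(m₁)` of the left dual `*C` on a comodule, as a map of `f`. -/
def act (M : RightComodule R C) (m : M.carrier) : (C →ₗ[R] R) →ₗ[Rᵐᵒᵖ] M.carrier :=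
  alphaMap R M.carrier C (M.coact m)

theorem act_add (M : RightComodule R C) (m m' : M.carrier) (f : C →ₗ[R] R) :
    M.act (m + m') f = M.act m f + M.act m' f := by
  simp only [act, map_add, LinearMap.add_apply]

theorem act_zero (M : RightComodule R C) (f : C →ₗ[R] R) : M.act 0 f = 0 := by
  simp only [act, map_zero, LinearMap.zero_apply]

theorem act_counit (M : RightComodule R C) (m : M.carrier) : M.act m Coring.counit = m := by
  rw [act, alphaMap_eq_rid, M.counit]

/-- `(m · f) · g = m · (f * g)`, where `(f * g)(c) = g(c₁ f(c₂))`. -/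
theorem act_act (M : RightComodule R C) (m : M.carrier) (f g : C →ₗ[R] R) :
    M.act (M.act m f) g = M.act m (g ∘ₗ convContract f ∘ₗ Coring.comul) := by
  rw [act, act, alphaMap_alphaMap, M.coassoc, alphaMap_map_id]
  rfl

theorem act_naturality {M N : RightComodule R C} (φ : M ⟶ N) (m : M.carrier) (f : C →ₗ[R] R) :
    N.act (Hom.toLin φ m) f = Hom.toLin φ (M.act m f) := by
  rw [act, Hom.colinear, alphaMap_naturality]
  rfl

/-- Under the left α-condition, subcomodules are the submodules stable under the left dual. -/
theorem isSubcomodule_iff (hC : LeftAlphaCondition R C)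
    {M : RightComodule R C} {L : Submodule Rᵐᵒᵖ M.carrier} :
    M.IsSubcomodule L ↔ ∀ x ∈ L, ∀ f, M.act x f ∈ L :=
  forall₂_congr fun x _ => hC.mem_range_map_subtype_iff L (M.coact x)

theorem isSubcomodule_top (hC : LeftAlphaCondition R C)
    (M : RightComodule R C) : M.IsSubcomodule ⊤ :=
  (isSubcomodule_iff hC).2 fun _ _ _ => Submodule.mem_top

theorem isSubcomodule_bot (hC : LeftAlphaCondition R C)
    (M : RightComodule R C) : M.IsSubcomodule ⊥ :=
  (isSubcomodule_iff hC).2 fun x hx f => by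
    rw [(Submodule.mem_bot _).1 hx, act_zero]
    exact Submodule.zero_mem _

theorem IsSubcomodule.sup (hC : LeftAlphaCondition R C)
    {M : RightComodule R C} {L L' : Submodule Rᵐᵒᵖ M.carrier}
    (hL : M.IsSubcomodule L) (hL' : M.IsSubcomodule L') : M.IsSubcomodule (L ⊔ L') := by
  rw [isSubcomodule_iff hC] at *
  intro x hx f
  obtain ⟨y, hy, z, hz, rfl⟩ := Submodule.mem_sup.1 hx
  rw [act_add]
  exact Submodule.add_mem_sup (hL y hy f) (hL' z hz f)

theorem IsSubcomodule.map (hC : LeftAlphaCondition R C) {M N : RightComodule R C} (φ : M ⟶ N)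
    {L : Submodule Rᵐᵒᵖ M.carrier} (hL : M.IsSubcomodule L) :
    N.IsSubcomodule (L.map (Hom.toLin φ)) := by
  rw [isSubcomodule_iff hC] at *
  rintro _ ⟨x, hx, rfl⟩ f
  exact ⟨M.act x f, hL x hx f, (act_naturality φ x f).symm⟩

theorem IsSubcomodule.comap (hC : LeftAlphaCondition R C) {M N : RightComodule R C} (φ : M ⟶ N)
    {L : Submodule Rᵐᵒᵖ N.carrier} (hL : N.IsSubcomodule L) :
    M.IsSubcomodule (L.comap (Hom.toLin φ)) := by
  rw [isSubcomodule_iff hC] at *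
  intro x hx f
  rw [Submodule.mem_comap, ← act_naturality]
  exact hL _ hx f

theorem isSubcomodule_range (hC : LeftAlphaCondition R C) {M N : RightComodule R C} (φ : M ⟶ N) :
    N.IsSubcomodule (LinearMap.range (Hom.toLin φ)) := by
  rw [LinearMap.range_eq_map]
  exact (isSubcomodule_top hC M).map hC φ

theorem isSubcomodule_ker (hC : LeftAlphaCondition R C) {M N : RightComodule R C} (φ : M ⟶ N) :
    M.IsSubcomodule (LinearMap.ker (Hom.toLin φ)) :=
  (isSubcomodule_bot hC N).comap hC φ

theorem isSubcomodule_range_act (hC : LeftAlphaCondition R C)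
    (M : RightComodule R C) (m : M.carrier) :
    M.IsSubcomodule (LinearMap.range (M.act m)) := by
  rw [isSubcomodule_iff hC]
  rintro _ ⟨g, rfl⟩ f
  exact ⟨_, (M.act_act m g f).symm⟩

/-- The finiteness theorem: a finite subset of a comodule lies in a subcomodule which is finitely
generated over `R`. -/
theorem exists_fg_isSubcomodule (hC : LeftAlphaCondition R C)
    [IsArtinianRing Rᵐᵒᵖ] (M : RightComodule R C)
    (s : Finset M.carrier) :
    ∃ L : Submodule Rᵐᵒᵖ M.carrier, M.IsSubcomodule L ∧ L.FG ∧ (s : Set M.carrier) ⊆ L := by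
  classical
  induction s using Finset.induction_on with
  | empty => exact ⟨⊥, isSubcomodule_bot hC M, Submodule.fg_bot, by simp⟩
  | insert m s _ ih =>
    obtain ⟨L, hL, hfg, hs⟩ := ih
    obtain ⟨L', hfg', hL'⟩ := exists_fg_alphaMap_mem (M.coact m)
    refine ⟨LinearMap.range (M.act m) ⊔ L, (isSubcomodule_range_act hC M m).sup hC hL,
      .sup ?_ hfg, ?_⟩
    · -- `m · *C` lies in a finitely generated module, which is noetherian over `R`.
      have : Module.Finite Rᵐᵒᵖ L' := Module.Finite.iff_fg.2 hfg'
      have hle : LinearMap.range (M.act m) ≤ L' := by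
        rintro _ ⟨f, rfl⟩
        exact hL' f
      have := isNoetherian_of_le hle
      exact Module.Finite.iff_fg.1 inferInstance
    · intro x hx
      rcases Finset.mem_insert.1 hx with rfl | hx
      · exact Submodule.mem_sup_left ⟨_, M.act_counit x⟩
      · exact Submodule.mem_sup_right (hs hx)

theorem FinitelyGenerated.finite (hC : LeftAlphaCondition R C)
    [IsArtinianRing Rᵐᵒᵖ] {M : RightComodule R C}
    (hM : M.FinitelyGenerated) : Module.Finite Rᵐᵒᵖ M.carrier := by
  obtain ⟨s, hs⟩ := hM
  obtain ⟨L, hL, hfg, hsL⟩ := exists_fg_isSubcomodule hC M s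
  rw [Module.finite_def, ← hs L hL hsL]
  exact hfg

theorem FinitelyGenerated.of_finite {M : RightComodule R C} [Module.Finite Rᵐᵒᵖ M.carrier] :
    M.FinitelyGenerated := by
  obtain ⟨s, hs⟩ := Module.Finite.fg_top (R := Rᵐᵒᵖ) (M := M.carrier)
  exact ⟨s, fun L _ hsL => top_le_iff.1 (hs ▸ Submodule.span_le.2 hsL)⟩

end RightComodule

/-! ### Kernels, images, quotients and isomorphisms of comodules -/

namespace RightComodule

variable {R C : Type u} [Ring R] [AddCommGroup C] [Module R C] [Module Rᵐᵒᵖ C]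
  [SMulCommClass R Rᵐᵒᵖ C] [Coring R C]

/-- The coaction of a subcomodule, obtained by restricting the codomain of `ρ` to `L ⊗_R C`, which
is a submodule of `M ⊗_R C` by flatness. -/
noncomputable def restrictCoact (hC : LeftAlphaCondition R C) {M : RightComodule R C}
    {L : Submodule Rᵐᵒᵖ M.carrier} (hL : M.IsSubcomodule L) : L →ₗ[Rᵐᵒᵖ] BalTensor R L C :=
  (LinearEquiv.ofInjective (BalTensor.rTensor C L.subtype)
      (hC.map_injective L.injective_subtype)).symm.toLinearMap ∘ₗ
    (M.coact ∘ₗ L.subtype).codRestrict (LinearMap.range (BalTensor.rTensor C L.subtype))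
      (fun x => hL x x.2)

theorem rTensor_restrictCoact (hC : LeftAlphaCondition R C) {M : RightComodule R C}
    {L : Submodule Rᵐᵒᵖ M.carrier} (hL : M.IsSubcomodule L) (x : L) :
    BalTensor.rTensor C L.subtype (restrictCoact hC hL x) = M.coact x :=
  congrArg Subtype.val (LinearEquiv.apply_symm_apply
    (LinearEquiv.ofInjective (BalTensor.rTensor C L.subtype)
      (hC.map_injective L.injective_subtype))
    ((M.coact ∘ₗ L.subtype).codRestrict (LinearMap.range (BalTensor.rTensor C L.subtype))
      (fun x => hL x x.2) x))

/-- A subcomodule of `M`, regarded as a comodule. -/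
noncomputable def ofSubcomodule (hC : LeftAlphaCondition R C) {M : RightComodule R C}
    {L : Submodule Rᵐᵒᵖ M.carrier} (hL : M.IsSubcomodule L) : RightComodule R C where
  carrier := L
  coact := restrictCoact hC hL
  coassoc x := by
    -- `L ⊗ (C ⊗ C) → M ⊗ (C ⊗ C)` is injective because `(L ⊗ C) ⊗ C → (M ⊗ C) ⊗ C` is.
    have hinj : Function.Injective (BalTensor.map L.subtype
        (LinearMap.id : BalTensor R C C →ₗ[R] BalTensor R C C)) := by
      intro y z h
      rw [← BalTensor.assoc_assocInv y, ← BalTensor.assoc_assocInv z,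
        ← BalTensor.assoc_naturality, ← BalTensor.assoc_naturality] at h
      have h' := hC.map_injective (φ := BalTensor.rTensor C L.subtype)
        (hC.map_injective L.injective_subtype)
        (Function.LeftInverse.injective BalTensor.assocInv_assoc h)
      rw [← BalTensor.assoc_assocInv y, h', BalTensor.assoc_assocInv]
    apply hinj
    have hρ : BalTensor.rTensor C L.subtype ∘ₗ restrictCoact hC hL = M.coact ∘ₗ L.subtype :=
      LinearMap.ext (rTensor_restrictCoact hC hL)
    have hx := rTensor_restrictCoact hC hL x
    rw [← BalTensor.assoc_naturality, BalTensor.map_map, hρ, BalTensor.map_map]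
    have := M.coassoc x
    rw [← hx, BalTensor.rTensor_apply, BalTensor.map_map, BalTensor.map_map] at this
    exact this
  counit x := by
    apply L.injective_subtype
    rw [← BalTensor.rid_naturality, BalTensor.map_map]
    have := M.counit x
    rw [← rTensor_restrictCoact hC hL x, BalTensor.rTensor_apply, BalTensor.map_map] at this
    exact this

/-- The inclusion of a subcomodule. -/
noncomputable def ι (hC : LeftAlphaCondition R C) {M : RightComodule R C}
    {L : Submodule Rᵐᵒᵖ M.carrier} (hL : M.IsSubcomodule L) : ofSubcomodule hC hL ⟶ M :=
  Hom.mk L.subtype fun x => (rTensor_restrictCoact hC hL x).symm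

theorem ι_injective (hC : LeftAlphaCondition R C) {M : RightComodule R C}
    {L : Submodule Rᵐᵒᵖ M.carrier} (hL : M.IsSubcomodule L) :
    Function.Injective (Hom.toLin (ι hC hL)) := L.injective_subtype

/-- A morphism with image in a subcomodule, with its codomain restricted. -/
noncomputable def codRestrict (hC : LeftAlphaCondition R C) {M N : RightComodule R C}
    {L : Submodule Rᵐᵒᵖ M.carrier} (hL : M.IsSubcomodule L) (f : N ⟶ M)
    (hf : ∀ n, Hom.toLin f n ∈ L) : N ⟶ ofSubcomodule hC hL :=
  Hom.mk ((Hom.toLin f).codRestrict L hf) fun n => by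
    refine hC.map_injective L.injective_subtype (.trans ?_ (BalTensor.map_map _ _ _ _ _).symm)
    exact (rTensor_restrictCoact hC hL _).trans (Hom.colinear f n)

@[simp] theorem codRestrict_ι (hC : LeftAlphaCondition R C) {M N : RightComodule R C}
    {L : Submodule Rᵐᵒᵖ M.carrier} (hL : M.IsSubcomodule L) (f : N ⟶ M)
    (hf : ∀ n, Hom.toLin f n ∈ L) : codRestrict hC hL f hf ≫ ι hC hL = f := rfl

/-- The quotient of a comodule by a subcomodule. -/
noncomputable def quotient {M : RightComodule R C} {L : Submodule Rᵐᵒᵖ M.carrier}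
    (hL : M.IsSubcomodule L) : RightComodule R C where
  carrier := M.carrier ⧸ L
  coact := L.liftQ (BalTensor.rTensor C L.mkQ ∘ₗ M.coact) fun x hx => by
    obtain ⟨y, hy⟩ := hL x hx
    rw [LinearMap.mem_ker, LinearMap.comp_apply, ← hy, BalTensor.rTensor_apply, BalTensor.map_map]
    have : L.mkQ ∘ₗ L.subtype = 0 := LinearMap.ext fun z => by simp
    rw [this]
    exact DFunLike.congr_fun (f := BalTensor.map 0 _) (g := 0)
      (BalTensor.hom_ext fun _ _ => BalTensor.zero_tmul _) y
  coassoc q := by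
    obtain ⟨m, rfl⟩ := L.mkQ_surjective q
    rw [Submodule.mkQ_apply, Submodule.liftQ_apply, LinearMap.comp_apply, BalTensor.rTensor_apply,
      BalTensor.map_map, Submodule.liftQ_mkQ, BalTensor.map_map]
    have := congrArg (BalTensor.map L.mkQ LinearMap.id) (M.coassoc m)
    rw [← BalTensor.assoc_naturality, BalTensor.map_map, BalTensor.map_map] at this
    exact this
  counit q := by
    obtain ⟨m, rfl⟩ := L.mkQ_surjective q
    rw [Submodule.mkQ_apply, Submodule.liftQ_apply, LinearMap.comp_apply, BalTensor.rTensor_apply,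
      BalTensor.map_map]
    have := congrArg L.mkQ (M.counit m)
    rw [← BalTensor.rid_naturality, BalTensor.map_map] at this
    exact this

/-- The projection onto a quotient comodule. -/
noncomputable def π {M : RightComodule R C} {L : Submodule Rᵐᵒᵖ M.carrier}
    (hL : M.IsSubcomodule L) : M ⟶ quotient hL :=
  Hom.mk L.mkQ fun _ => rfl

theorem π_surjective {M : RightComodule R C} {L : Submodule Rᵐᵒᵖ M.carrier}
    (hL : M.IsSubcomodule L) : Function.Surjective (Hom.toLin (π hL)) := L.mkQ_surjective

theorem epi_of_surjective {M N : RightComodule R C} {f : M ⟶ N}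
    (hf : Function.Surjective (Hom.toLin f)) : Epi f where
  left_cancellation _ _ e := hom_ext fun n => by
    obtain ⟨m, rfl⟩ := hf n
    exact LinearMap.congr_fun (congrArg Hom.toLin e) m

theorem mono_of_injective {M N : RightComodule R C} {f : M ⟶ N}
    (hf : Function.Injective (Hom.toLin f)) : Mono f where
  right_cancellation _ _ e := hom_ext fun n => hf (LinearMap.congr_fun (congrArg Hom.toLin e) n)

theorem surjective_of_epi (hC : LeftAlphaCondition R C) {M N : RightComodule R C} (f : M ⟶ N)
    [Epi f] : Function.Surjective (Hom.toLin f) := by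
  have h : f ≫ π (isSubcomodule_range hC f) = f ≫ 0 := hom_ext fun m =>
    (Submodule.Quotient.mk_eq_zero _).2 ⟨m, rfl⟩
  intro n
  have := LinearMap.congr_fun (congrArg Hom.toLin ((cancel_epi f).1 h)) n
  exact (Submodule.Quotient.mk_eq_zero _).1 this

theorem injective_of_mono (hC : LeftAlphaCondition R C) {M N : RightComodule R C} (f : M ⟶ N)
    [Mono f] : Function.Injective (Hom.toLin f) := by
  have h : ι hC (isSubcomodule_ker hC f) ≫ f = 0 ≫ f := hom_ext fun m =>
    m.2.trans (map_zero (Hom.toLin f)).symm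
  refine (injective_iff_map_eq_zero _).2 fun n hn => ?_
  exact LinearMap.congr_fun (congrArg Hom.toLin ((cancel_mono f).1 h)) ⟨n, hn⟩

theorem isIso_of_bijective {M N : RightComodule R C} {f : M ⟶ N}
    (hf : Function.Bijective (Hom.toLin f)) : IsIso f := by
  let e := LinearEquiv.ofBijective (Hom.toLin f) hf
  have h₁ : e.symm.toLinearMap ∘ₗ Hom.toLin f = LinearMap.id := LinearMap.ext e.symm_apply_apply
  have h₂ : Hom.toLin f ∘ₗ e.symm.toLinearMap = LinearMap.id := LinearMap.ext e.apply_symm_apply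
  refine ⟨Hom.mk e.symm.toLinearMap fun n => ?_, Hom.ext h₁, Hom.ext h₂⟩
  obtain ⟨m, rfl⟩ := hf.2 n
  rw [Hom.colinear, BalTensor.map_map, h₁]
  exact (congrArg M.coact (LinearMap.congr_fun h₁ m)).trans (BalTensor.map_id_id _).symm

theorem bijective_of_isIso {M N : RightComodule R C} (f : M ⟶ N) [IsIso f] :
    Function.Bijective (Hom.toLin f) :=
  Function.bijective_iff_has_inverse.2 ⟨Hom.toLin (inv f),
    LinearMap.congr_fun (congrArg Hom.toLin (IsIso.hom_inv_id f)),
    LinearMap.congr_fun (congrArg Hom.toLin (IsIso.inv_hom_id f))⟩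

/-! ### Simple comodules -/

theorem eq_bot_or_eq_top_of_simple (hC : LeftAlphaCondition R C) {S : RightComodule R C} [Simple S]
    {L : Submodule Rᵐᵒᵖ S.carrier} (hL : S.IsSubcomodule L) : L = ⊥ ∨ L = ⊤ := by
  have := mono_of_injective (ι_injective hC hL)
  rw [or_iff_not_imp_left]
  intro hne
  have h0 : ι hC hL ≠ 0 := fun h => hne <| (Submodule.eq_bot_iff L).2 fun x hx =>
    LinearMap.congr_fun (congrArg Hom.toLin h) ⟨x, hx⟩
  have := isIso_of_mono_of_nonzero h0
  rw [← L.range_subtype]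
  exact LinearMap.range_eq_top.2 (bijective_of_isIso (ι hC hL)).2

theorem exists_ne_zero_of_simple (S : RightComodule R C) [Simple S] : ∃ x : S.carrier, x ≠ 0 := by
  by_contra! h
  exact id_nonzero S (hom_ext h)

/-- A proper subcomodule that is maximal among the proper subcomodules has simple quotient. -/
theorem simple_quotient (hC : LeftAlphaCondition R C) {M : RightComodule R C}
    {L : Submodule Rᵐᵒᵖ M.carrier} (hL : M.IsSubcomodule L) (htop : L ≠ ⊤)
    (hmax : ∀ L', M.IsSubcomodule L' → L < L' → L' = ⊤) : Simple (quotient hL) where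
  mono_isIso_iff_nonzero {Y} f _ := by
    constructor
    · rintro _ rfl
      refine htop (Submodule.eq_top_iff'.2 fun m => ?_)
      obtain ⟨y, hy⟩ := (bijective_of_isIso (0 : Y ⟶ quotient hL)).2 (L.mkQ m)
      exact (Submodule.Quotient.mk_eq_zero L).1 hy.symm
    · intro hf
      refine isIso_of_bijective ⟨injective_of_mono hC f, ?_⟩
      have hL' := (isSubcomodule_range hC f).comap hC (π hL)
      have hle : L ≤ (LinearMap.range (Hom.toLin f)).comap (Hom.toLin (π hL)) := fun x hx =>
        ⟨0, (map_zero _).trans ((Submodule.Quotient.mk_eq_zero L).2 hx).symm⟩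
      have htop' := hmax _ hL' <| lt_of_le_of_ne hle fun h => hf <| hom_ext fun y => by
        obtain ⟨m, hm⟩ := π_surjective hL (Hom.toLin f y)
        have : m ∈ L := by
          rw [h]
          exact ⟨y, hm.symm⟩
        rw [← hm]
        exact (Submodule.Quotient.mk_eq_zero L).2 this
      intro q
      obtain ⟨m, rfl⟩ := π_surjective hL q
      exact Submodule.eq_top_iff'.1 htop' m

theorem finitelyGenerated_of_simple (hC : LeftAlphaCondition R C) (S : RightComodule R C)
    [Simple S] : S.FinitelyGenerated := by
  obtain ⟨x, hx⟩ := exists_ne_zero_of_simple S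
  refine ⟨{x}, fun L hL hxL => (eq_bot_or_eq_top_of_simple hC hL).resolve_left ?_⟩
  rintro rfl
  exact hx (hxL (by simp))

end RightComodule

/-! ### Coproducts of comodules -/

namespace RightComodule

variable {R C : Type u} [Ring R] [AddCommGroup C] [Module R C] [Module Rᵐᵒᵖ C]
  [SMulCommClass R Rᵐᵒᵖ C] [Coring R C]

section Coproduct

variable {I : Type u} (X : I → RightComodule R C)

open scoped Classical in
/-- The inclusion of a summand, as an `R`-linear map. -/
noncomputable def directSumInj (i : I) : (X i).carrier →ₗ[Rᵐᵒᵖ] Π₀ i, (X i).carrier :=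
  DFinsupp.lsingle (M := fun i => (X i).carrier) i

open scoped Classical in
/-- The `R`-linear map out of a direct sum induced by a family of maps. -/
noncomputable def directSumLift {A : Type u} [AddCommGroup A] [Module Rᵐᵒᵖ A]
    (f : ∀ i, (X i).carrier →ₗ[Rᵐᵒᵖ] A) : (Π₀ i, (X i).carrier) →ₗ[Rᵐᵒᵖ] A :=
  DFinsupp.lsum ℕ f

theorem directSumLift_inj {A : Type u} [AddCommGroup A] [Module Rᵐᵒᵖ A]
    (f : ∀ i, (X i).carrier →ₗ[Rᵐᵒᵖ] A) (i : I) (m : (X i).carrier) :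
    directSumLift X f (directSumInj X i m) = f i m := by
  classical
  exact DFinsupp.lsum_single ℕ f i m

theorem directSum_lhom_ext {A : Type u} [AddCommGroup A] [Module Rᵐᵒᵖ A]
    {f g : (Π₀ i, (X i).carrier) →ₗ[Rᵐᵒᵖ] A}
    (h : ∀ i m, f (directSumInj X i m) = g (directSumInj X i m)) : f = g := by
  classical
  exact DFinsupp.lhom_ext h

theorem directSum_induction {p : (Π₀ i, (X i).carrier) → Prop} (h0 : p 0)
    (hi : ∀ i m, p (directSumInj X i m)) (ha : ∀ x y, p x → p y → p (x + y))
    (x : Π₀ i, (X i).carrier) : p x := by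
  classical
  induction x using DFinsupp.induction with
  | h0 => exact h0
  | ha i m f _ _ hf => exact ha _ _ (hi i m) hf

/-- The projection onto a summand, as an `R`-linear map. -/
def directSumCoord (i : I) : (Π₀ i, (X i).carrier) →ₗ[Rᵐᵒᵖ] (X i).carrier :=
  DFinsupp.lapply (M := fun i => (X i).carrier) i

theorem directSumCoord_comp_inj (i : I) :
    directSumCoord X i ∘ₗ directSumInj X i = LinearMap.id := by
  classical
  exact LinearMap.ext fun m => by simp [directSumCoord, directSumInj]

theorem directSumCoord_comp_inj_of_ne {i j : I} (h : j ≠ i) :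
    directSumCoord X i ∘ₗ directSumInj X j = 0 := by
  classical
  exact LinearMap.ext fun m => by simp [directSumCoord, directSumInj, DFinsupp.single_apply, h]

theorem directSumLift_eq_zero {A : Type u} [AddCommGroup A] [Module Rᵐᵒᵖ A]
    (f : ∀ i, (X i).carrier →ₗ[Rᵐᵒᵖ] A) (x : Π₀ i, (X i).carrier)
    (h : ∀ i, f i (directSumCoord X i x) = 0) : directSumLift X f x = 0 := by
  classical
  rw [directSumLift, DFinsupp.lsum_apply_apply, DFinsupp.sumAddHom_apply]
  exact Finset.sum_eq_zero fun i _ => h i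

/-- The coaction on a direct sum of comodules. -/
noncomputable def directSumCoact :
    (Π₀ i, (X i).carrier) →ₗ[Rᵐᵒᵖ] BalTensor R (Π₀ i, (X i).carrier) C :=
  directSumLift X fun i => BalTensor.rTensor C (directSumInj X i) ∘ₗ (X i).coact

theorem directSumCoact_inj (i : I) (m : (X i).carrier) :
    directSumCoact X (directSumInj X i m) =
      BalTensor.map (directSumInj X i) LinearMap.id ((X i).coact m) :=
  directSumLift_inj X _ i m

theorem directSumCoact_comp_inj (i : I) :
    directSumCoact X ∘ₗ directSumInj X i =
      BalTensor.rTensor C (directSumInj X i) ∘ₗ (X i).coact :=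
  LinearMap.ext (directSumCoact_inj X i)

/-- The direct sum of a family of comodules. -/
noncomputable def directSum : RightComodule R C where
  carrier := Π₀ i, (X i).carrier
  coact := directSumCoact X
  coassoc x := by
    induction x using directSum_induction with
    | h0 => simp only [map_zero]
    | hi i m =>
      rw [directSumCoact_inj, BalTensor.map_map, directSumCoact_comp_inj, BalTensor.map_map]
      have := congrArg (BalTensor.map (directSumInj X i) LinearMap.id) ((X i).coassoc m)
      rw [← BalTensor.assoc_naturality, BalTensor.map_map, BalTensor.map_map] at this
      exact this
    | ha x y hx hy => simp only [map_add, hx, hy]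
  counit x := by
    induction x using directSum_induction with
    | h0 => simp only [map_zero]
    | hi i m =>
      rw [directSumCoact_inj, BalTensor.map_map]
      have := congrArg (directSumInj X i) ((X i).counit m)
      rw [← BalTensor.rid_naturality, BalTensor.map_map] at this
      exact this
    | ha x y hx hy => simp only [map_add, hx, hy]

/-- The inclusion of a summand. -/
noncomputable def directSumι (i : I) : X i ⟶ directSum X :=
  Hom.mk (directSumInj X i) (directSumCoact_inj X i)

/-- The morphism out of a direct sum of comodules induced by a family of morphisms. -/
noncomputable def directSumDesc {Y : RightComodule R C} (f : ∀ i, X i ⟶ Y) : directSum X ⟶ Y :=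
  Hom.mk (directSumLift X fun i => Hom.toLin (f i)) <|
    LinearMap.congr_fun (f := Y.coact ∘ₗ directSumLift X fun i => Hom.toLin (f i))
      (g := BalTensor.rTensor C (directSumLift X fun i => Hom.toLin (f i)) ∘ₗ directSumCoact X) <|
    directSum_lhom_ext X fun i m => by
      have h : directSumLift X (fun i => Hom.toLin (f i)) ∘ₗ directSumInj X i = Hom.toLin (f i) :=
        LinearMap.ext (directSumLift_inj X (fun i => Hom.toLin (f i)) i)
      rw [LinearMap.comp_apply, LinearMap.comp_apply, directSumCoact_inj, BalTensor.rTensor_apply,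
        BalTensor.map_map, h, directSumLift_inj]
      exact Hom.colinear (f i) m

/-- The projection of a direct sum of comodules onto a summand. -/
noncomputable def directSumProj (i : I) : directSum X ⟶ X i :=
  Hom.mk (directSumCoord X i) fun x => by
    change (X i).coact (directSumCoord X i x) =
      BalTensor.map (directSumCoord X i) LinearMap.id (directSumCoact X x)
    induction x using directSum_induction with
    | h0 => simp only [map_zero]
    | hi j m =>
      rw [directSumCoact_inj, BalTensor.map_map]
      by_cases h : j = i
      · subst h
        rw [directSumCoord_comp_inj, ← LinearMap.comp_apply (directSumCoord X j),
          directSumCoord_comp_inj]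
        exact (BalTensor.map_id_id _).symm
      · rw [directSumCoord_comp_inj_of_ne X h, ← LinearMap.comp_apply (directSumCoord X i),
          directSumCoord_comp_inj_of_ne X h, LinearMap.zero_apply, map_zero]
        exact DFunLike.congr_fun (f := 0) (g := BalTensor.map 0 _)
          (BalTensor.hom_ext fun _ _ => (BalTensor.zero_tmul _).symm) _
    | ha x y hx hy => simp only [map_add, hx, hy]

theorem directSumDesc_eq_zero {Y : RightComodule R C} (f : ∀ i, X i ⟶ Y)
    (z : (directSum X).carrier)
    (h : ∀ i, Hom.toLin (f i) (Hom.toLin (directSumProj X i) z) = 0) :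
    Hom.toLin (directSumDesc X f) z = 0 :=
  directSumLift_eq_zero X _ z h

/-- The direct sum as a cofan. -/
noncomputable def directSumCofan : Limits.Cofan X :=
  Limits.Cofan.mk (directSum X) (directSumι X)

/-- The direct sum is the coproduct in the category of comodules. -/
noncomputable def isColimitDirectSumCofan : Limits.IsColimit (directSumCofan X) :=
  Limits.Cofan.IsColimit.mk _
    (fun t => directSumDesc X t.inj)
    (fun t i => hom_ext (directSumLift_inj X (fun i => Hom.toLin (t.inj i)) i))
    (fun t _ hf => Hom.ext (directSum_lhom_ext X fun i m =>
      (LinearMap.congr_fun (congrArg Hom.toLin (hf i)) m).trans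
        (directSumLift_inj X (fun i => Hom.toLin (t.inj i)) i m).symm))

instance : Limits.HasCoproducts.{u} (RightComodule R C) :=
  Limits.hasCoproducts_of_colimit_cofans directSumCofan isColimitDirectSumCofan

instance : Limits.HasFiniteCoproducts (RightComodule R C) :=
  Limits.hasFiniteCoproducts_of_hasCoproducts.{u} _

/-- `X ⨿ Y` is the sum of the images of `X` and `Y`. -/
theorem range_inl_sup_range_inr (hC : LeftAlphaCondition R C) (X Y : RightComodule R C) :
    LinearMap.range (Hom.toLin (Limits.coprod.inl : X ⟶ X ⨿ Y)) ⊔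
      LinearMap.range (Hom.toLin (Limits.coprod.inr : Y ⟶ X ⨿ Y)) = ⊤ := by
  have hL := (isSubcomodule_range hC (Limits.coprod.inl : X ⟶ X ⨿ Y)).sup hC
    (isSubcomodule_range hC (Limits.coprod.inr : Y ⟶ X ⨿ Y))
  let f : X ⨿ Y ⟶ ofSubcomodule hC hL := Limits.coprod.desc
    (codRestrict hC hL Limits.coprod.inl fun x => Submodule.mem_sup_left ⟨x, rfl⟩)
    (codRestrict hC hL Limits.coprod.inr fun y => Submodule.mem_sup_right ⟨y, rfl⟩)
  have hf : f ≫ ι hC hL = 𝟙 _ := by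
    apply Limits.coprod.hom_ext
    · rw [← Category.assoc, Limits.coprod.inl_desc, codRestrict_ι, Category.comp_id]
    · rw [← Category.assoc, Limits.coprod.inr_desc, codRestrict_ι, Category.comp_id]
  refine Submodule.eq_top_iff'.2 fun z => ?_
  have hz : Hom.toLin (ι hC hL) (Hom.toLin f z) = z :=
    LinearMap.congr_fun (congrArg Hom.toLin hf) z
  exact hz ▸ (Hom.toLin f z).2

theorem finite_coprod (hC : LeftAlphaCondition R C) (X Y : RightComodule R C)
    [Module.Finite Rᵐᵒᵖ X.carrier] [Module.Finite Rᵐᵒᵖ Y.carrier] :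
    Module.Finite Rᵐᵒᵖ (X ⨿ Y).carrier := by
  rw [Module.finite_def, ← range_inl_sup_range_inr hC X Y]
  exact .sup (Module.Finite.iff_fg.1 inferInstance) (Module.Finite.iff_fg.1 inferInstance)

end Coproduct

end RightComodule

/-! ### Splitting off finitely generated projective summands -/

namespace RightComodule

variable {R C : Type u} [Ring R] [AddCommGroup C] [Module R C] [Module Rᵐᵒᵖ C]
  [SMulCommClass R Rᵐᵒᵖ C] [Coring R C]

theorem exists_toLin_eq_pow {P M : RightComodule R C} {e : P ⟶ P} {f : P ⟶ M} (he : e ≫ f = f)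
    (n : ℕ) : ∃ g : P ⟶ P, Hom.toLin g = Hom.toLin e ^ n ∧ g ≫ f = f := by
  induction n with
  | zero => exact ⟨𝟙 P, (pow_zero _).symm, Category.id_comp f⟩
  | succ n ih =>
    obtain ⟨g, hg, hgf⟩ := ih
    exact ⟨e ≫ g, by rw [comp_toLin, hg, pow_succ]; rfl, by rw [Category.assoc, hgf, he]⟩

/-- Fitting's lemma for an endomorphism with image of finite length: some power `g` of `T` satisfies
`P = im g ⊕ ker g`, since it restricts to a bijection of `im g`. -/
theorem _root_.LinearMap.exists_pow_bijective_on_range {A P : Type*} [Ring A] [AddCommGroup P]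
    [Module A P] (T : Module.End A P) [IsArtinian A (LinearMap.range T)]
    [IsNoetherian A (LinearMap.range T)] :
    ∃ n, LinearMap.range (T ^ (n + 1)) ≤ LinearMap.range T ∧
      (∀ x ∈ LinearMap.range (T ^ (n + 1)), (T ^ (n + 1)) x = 0 → x = 0) ∧
      ∀ x ∈ LinearMap.range (T ^ (n + 1)), ∃ y ∈ LinearMap.range (T ^ (n + 1)),
        (T ^ (n + 1)) y = x := by
  have hle (n : ℕ) : LinearMap.range (T ^ (n + 1)) ≤ LinearMap.range T := by
    rintro _ ⟨x, rfl⟩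
    exact ⟨(T ^ n) x, by rw [pow_succ']; rfl⟩
  have hanti : Antitone fun n => LinearMap.range (T ^ (n + 1)) := by
    refine antitone_nat_of_succ_le fun n => ?_
    rintro _ ⟨x, rfl⟩
    exact ⟨T x, by rw [pow_succ _ (n + 1)]; rfl⟩
  obtain ⟨n, hn⟩ := IsArtinian.monotone_stabilizes (R := A) (M := LinearMap.range T)
    ⟨fun n => OrderDual.toDual ((LinearMap.range (T ^ (n + 1))).comap (LinearMap.range T).subtype),
      fun a b h => Submodule.comap_mono (hanti h)⟩
  have hn' : LinearMap.range (T ^ (n + 1)) ≤ LinearMap.range (T ^ (n + 1 + n + 1)) := fun x hx => by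
    have h := congrArg OrderDual.ofDual (hn (n + 1 + n) (by omega))
    exact h.le (show (⟨x, hle n hx⟩ : LinearMap.range T) ∈
      (LinearMap.range (T ^ (n + 1))).comap (LinearMap.range T).subtype from hx)
  have hsurj : ∀ x ∈ LinearMap.range (T ^ (n + 1)), ∃ y ∈ LinearMap.range (T ^ (n + 1)),
      (T ^ (n + 1)) y = x := fun x hx => by
    obtain ⟨y, rfl⟩ := hn' hx
    exact ⟨_, ⟨y, rfl⟩, by rw [add_assoc _ n 1, pow_add T (n + 1) (n + 1)]; rfl⟩
  refine ⟨n, hle n, fun x hx h0 => ?_, hsurj⟩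
  have := isNoetherian_of_le (hle n)
  let t := (T ^ (n + 1)).restrict (p := LinearMap.range (T ^ (n + 1)))
    (q := LinearMap.range (T ^ (n + 1))) fun x _ => ⟨x, rfl⟩
  have ht : Function.Injective t := by
    refine IsNoetherian.injective_of_surjective_endomorphism t fun x => ?_
    obtain ⟨y, hy, hyx⟩ := hsurj x x.2
    exact ⟨⟨y, hy⟩, Subtype.ext hyx⟩
  exact congrArg Subtype.val
    ((injective_iff_map_eq_zero t).1 ht ⟨x, hx⟩ (Subtype.ext h0))

/-- If an endomorphism `e` of a projective comodule `P` with image of finite length is compatible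
with an epimorphism `f : P ⟶ M`, then a summand of `P` inside the image of `e` still maps onto
`M`. -/
theorem exists_projective_range_le (hC : LeftAlphaCondition R C) [IsArtinianRing Rᵐᵒᵖ]
    {P M : RightComodule R C} [Projective P] {e : P ⟶ P} {f : P ⟶ M} (he : e ≫ f = f)
    (hf : Function.Surjective (Hom.toLin f))
    [Module.Finite Rᵐᵒᵖ (LinearMap.range (Hom.toLin e))] :
    ∃ (E : RightComodule R C) (i : E ⟶ P), Projective E ∧ Module.Finite Rᵐᵒᵖ E.carrier ∧
      Function.Injective (Hom.toLin i) ∧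
      LinearMap.range (Hom.toLin i) ≤ LinearMap.range (Hom.toLin e) ∧
      Function.Surjective (Hom.toLin (i ≫ f)) := by
  obtain ⟨n, hle, hinj, hsurj⟩ :=
    LinearMap.exists_pow_bijective_on_range (A := Rᵐᵒᵖ) (P := P.carrier) (Hom.toLin e)
  obtain ⟨g, hg, hgf⟩ := exists_toLin_eq_pow he (n + 1)
  rw [← hg] at hle hinj hsurj
  have hL := isSubcomodule_range hC g
  let r := codRestrict hC hL g fun p => ⟨p, rfl⟩
  have hbij : Function.Bijective (Hom.toLin (ι hC hL ≫ r)) := by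
    constructor
    · refine (injective_iff_map_eq_zero _).2 fun x hx => Subtype.ext ?_
      exact hinj x.1 x.2 (congrArg Subtype.val hx)
    · intro x
      obtain ⟨y, hy, hyx⟩ := hsurj x.1 x.2
      exact ⟨⟨y, hy⟩, Subtype.ext hyx⟩
  have := isIso_of_bijective hbij
  have hret : Retract (ofSubcomodule hC hL) P :=
    ⟨ι hC hL, r ≫ inv (ι hC hL ≫ r), by rw [← Category.assoc, IsIso.hom_inv_id]⟩
  have := isNoetherian_of_le hle
  refine ⟨_, ι hC hL, hret.projective, ?_, ι_injective hC hL, ?_, fun m => ?_⟩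
  · exact inferInstanceAs (Module.Finite Rᵐᵒᵖ (LinearMap.range (Hom.toLin g)))
  · exact (Submodule.range_subtype _).trans_le hle
  · obtain ⟨p, rfl⟩ := hf m
    exact ⟨⟨Hom.toLin g p, p, rfl⟩, LinearMap.congr_fun (congrArg Hom.toLin hgf) p⟩

/-- A quotient of a finitely generated projective comodule has a finitely generated projective
cover, namely one of minimal length. -/
theorem hasFGProjectiveCover_of_surjective (hC : LeftAlphaCondition R C) [IsArtinianRing Rᵐᵒᵖ]
    {P M : RightComodule R C} [Projective P] [hfin : Module.Finite Rᵐᵒᵖ P.carrier] (f : P ⟶ M)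
    (hf : Function.Surjective (Hom.toLin f)) : M.HasFGProjectiveCover := by
  induction hn : Module.length Rᵐᵒᵖ P.carrier using WellFoundedLT.induction generalizing P with
  | ind n ih =>
  by_cases hsup : ∀ L : Submodule Rᵐᵒᵖ P.carrier, P.IsSubcomodule L →
      LinearMap.ker (Hom.toLin f) ⊔ L = ⊤ → L = ⊤
  · exact ⟨P, f, ⟨inferInstance, epi_of_surjective hf, hsup⟩, .of_finite⟩
  · push Not at hsup
    obtain ⟨L, hL, hsum, hne⟩ := hsup
    have hsurj : Function.Surjective (Hom.toLin (ι hC hL ≫ f)) := by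
      intro m
      obtain ⟨p, rfl⟩ := hf m
      obtain ⟨y, hy, z, hz, rfl⟩ := Submodule.mem_sup.1 (hsum ▸ Submodule.mem_top : p ∈ _)
      refine ⟨⟨z, hz⟩, ?_⟩
      rw [map_add, LinearMap.mem_ker.1 hy, zero_add]
      rfl
    have := epi_of_surjective hsurj
    let k := Projective.factorThru f (ι hC hL ≫ f)
    have hk : (k ≫ ι hC hL) ≫ f = f := by
      rw [Category.assoc]
      exact Projective.factorThru_comp f (ι hC hL ≫ f)
    have hrange : LinearMap.range (Hom.toLin (k ≫ ι hC hL)) ≤ L := by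
      rintro _ ⟨p, rfl⟩
      exact (Hom.toLin k p).2
    obtain ⟨E, i, hE, hEfin, hi, hiL, hEf⟩ := exists_projective_range_le hC hk hf
    refine ih _ ?_ (i ≫ f) hEf rfl
    rw [← hn, (LinearEquiv.ofInjective _ hi).length_eq]
    exact Submodule.length_lt fun h => hne (top_le_iff.1 (h ▸ hiL.trans hrange))

/-- A nonzero morphism on a projective comodule `P` remains nonzero after composition with some
endomorphism of `P` with finitely generated image: `P` is a direct summand of a direct sum of
finitely generated subcomodules. -/
theorem exists_finite_range_comp_ne_zero (hC : LeftAlphaCondition R C) [IsArtinianRing Rᵐᵒᵖ]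
    {P M : RightComodule R C} [Projective P] {f : P ⟶ M} (hf : f ≠ 0) :
    ∃ u : P ⟶ P, Module.Finite Rᵐᵒᵖ (LinearMap.range (Hom.toLin u)) ∧ u ≫ f ≠ 0 := by
  choose L hL hfg hmem using fun p : P.carrier => exists_fg_isSubcomodule hC P {p}
  let X p := ofSubcomodule hC (hL p)
  have hfin (p) : Module.Finite Rᵐᵒᵖ (X p).carrier := Module.Finite.iff_fg.2 (hfg p)
  let q := directSumDesc X fun p => ι hC (hL p)
  have hq : Function.Surjective (Hom.toLin q) := fun p =>
    ⟨directSumInj X p ⟨p, hmem p (by simp)⟩, directSumLift_inj X (fun p => Hom.toLin _) p _⟩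
  have := epi_of_surjective hq
  let s := Projective.factorThru (𝟙 P) q
  have hs : s ≫ q = 𝟙 P := Projective.factorThru_comp _ _
  by_contra! h
  refine hf (hom_ext fun x => ?_)
  have hqf : q ≫ f = directSumDesc X fun p => ι hC (hL p) ≫ f :=
    Hom.ext (directSum_lhom_ext X fun p m =>
      (congrArg (Hom.toLin f) (directSumLift_inj X (fun p => Hom.toLin _) p m)).trans
        (directSumLift_inj X (fun p => Hom.toLin (ι hC (hL p) ≫ f)) p m).symm)
  have hx : Hom.toLin f x = Hom.toLin (q ≫ f) (Hom.toLin s x) :=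
    congrArg (Hom.toLin f) (LinearMap.congr_fun (congrArg Hom.toLin hs) x).symm
  rw [hx, hqf]
  refine directSumDesc_eq_zero X _ _ fun p => ?_
  refine LinearMap.congr_fun (congrArg Hom.toLin
    (h (s ≫ directSumProj X p ≫ ι hC (hL p)) ?_)) x
  have hle : LinearMap.range (Hom.toLin (s ≫ directSumProj X p ≫ ι hC (hL p))) ≤ L p := by
    rintro _ ⟨y, rfl⟩
    exact (Hom.toLin (directSumProj X p) (Hom.toLin s y)).2
  have : Module.Finite Rᵐᵒᵖ (L p) := hfin p
  have := isNoetherian_of_le hle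
  infer_instance

theorem surjective_of_ne_zero_of_simple (hC : LeftAlphaCondition R C) {M S : RightComodule R C}
    [Simple S] {f : M ⟶ S} (hf : f ≠ 0) : Function.Surjective (Hom.toLin f) := by
  refine LinearMap.range_eq_top.1
    ((eq_bot_or_eq_top_of_simple hC (isSubcomodule_range hC f)).resolve_left fun h => hf ?_)
  exact Hom.ext (LinearMap.range_eq_bot.1 h)

/-- A simple comodule admitting a nonzero morphism `f` from a projective comodule `P`, possibly of
infinite length, has a finitely generated projective cover: some endomorphism `e` of `P` with image
of finite length satisfies `e ≫ f = f`. -/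
theorem hasFGProjectiveCover_of_simple (hC : LeftAlphaCondition R C) [IsArtinianRing Rᵐᵒᵖ]
    {P S : RightComodule R C} [Projective P] [Simple S] {f : P ⟶ S} (hf : f ≠ 0) :
    S.HasFGProjectiveCover := by
  obtain ⟨u, hu, huf⟩ := exists_finite_range_comp_ne_zero hC hf
  have := epi_of_surjective (surjective_of_ne_zero_of_simple hC huf)
  let v := Projective.factorThru f (u ≫ f)
  have he : (v ≫ u) ≫ f = f := by
    rw [Category.assoc]
    exact Projective.factorThru_comp f (u ≫ f)
  have hle : LinearMap.range (Hom.toLin (v ≫ u)) ≤ LinearMap.range (Hom.toLin u) :=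
    LinearMap.range_comp_le_range _ _
  have := isNoetherian_of_le hle
  obtain ⟨E, i, hE, hEfin, -, -, hEf⟩ :=
    exists_projective_range_le hC he (surjective_of_ne_zero_of_simple hC hf)
  exact hasFGProjectiveCover_of_surjective hC (i ≫ f) hEf

/-! ### From simple comodules to all comodules -/

/-- A projective cover of a finitely generated comodule is finitely generated, because preimages of
generators generate it. -/
theorem FinitelyGenerated.of_isProjectiveCover (hC : LeftAlphaCondition R C)
    {P M : RightComodule R C} {f : P ⟶ M} (hf : IsProjectiveCover f) (hM : M.FinitelyGenerated) :
    P.FinitelyGenerated := by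
  classical
  obtain ⟨s, hs⟩ := hM
  have := hf.epi
  choose g hg using surjective_of_epi hC f
  refine ⟨s.image g, fun L hL hsL => hf.superfluous L hL ?_⟩
  have htop : L.map (Hom.toLin f) = ⊤ := hs _ (hL.map hC f) fun x hx =>
    ⟨g x, hsL (by simpa using ⟨x, hx, rfl⟩), hg x⟩
  rw [sup_comm, ← Submodule.comap_map_eq, htop, Submodule.comap_top]

theorem HasProjectiveCover.fg (hC : LeftAlphaCondition R C) {M : RightComodule R C}
    (h : M.HasProjectiveCover) (hM : M.FinitelyGenerated) : M.HasFGProjectiveCover := by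
  obtain ⟨P, f, hf⟩ := h
  exact ⟨P, f, hf, hM.of_isProjectiveCover hC hf⟩

theorem exists_simple_quotient (hC : LeftAlphaCondition R C) {M : RightComodule R C}
    [IsNoetherian Rᵐᵒᵖ M.carrier] {L : Submodule Rᵐᵒᵖ M.carrier} (hL : M.IsSubcomodule L)
    (hne : L ≠ ⊤) :
    ∃ (L' : Submodule Rᵐᵒᵖ M.carrier) (hL' : M.IsSubcomodule L'), L ≤ L' ∧ L' ≠ ⊤ ∧
      Simple (quotient hL') := by
  obtain ⟨L', ⟨hL', hle, hne'⟩, hmax⟩ := set_has_maximal_iff_noetherian.2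
    (inferInstanceAs (IsNoetherian Rᵐᵒᵖ M.carrier))
    {L' | M.IsSubcomodule L' ∧ L ≤ L' ∧ L' ≠ ⊤} ⟨L, hL, le_rfl, hne⟩
  refine ⟨L', hL', hle, hne', simple_quotient hC hL' hne' fun K hK hlt => ?_⟩
  by_contra hK'
  exact hmax K ⟨hK, hle.trans hlt.le, hK'⟩ hlt

theorem projective_ofSubcomodule_bot (hC : LeftAlphaCondition R C) (M : RightComodule R C) :
    Projective (ofSubcomodule hC (isSubcomodule_bot hC M)) where
  factors f e _ := ⟨0, hom_ext fun x => by
    have hx : x = 0 := Subtype.ext ((Submodule.mem_bot _).1 x.2)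
    rw [hx, map_zero, map_zero]⟩

/-- If the simple comodules have finitely generated projective covers, every finitely generated
comodule `M` is a quotient of a finitely generated projective one. A proper image `L` of a finitely
generated projective comodule in `M` is never maximal: the projective cover of a simple quotient of
`M/L` lifts to `M`, and its image is not contained in `L`. -/
theorem exists_finite_projective_surjective (hC : LeftAlphaCondition R C) [IsArtinianRing Rᵐᵒᵖ]
    (h : ∀ S : RightComodule R C, Simple S → S.HasFGProjectiveCover)
    (M : RightComodule R C) [Module.Finite Rᵐᵒᵖ M.carrier] :
    ∃ (P : RightComodule R C) (f : P ⟶ M), Projective P ∧ Module.Finite Rᵐᵒᵖ P.carrier ∧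
      Function.Surjective (Hom.toLin f) := by
  obtain ⟨_, ⟨P, f, hP, hfin, rfl⟩, hmax⟩ := set_has_maximal_iff_noetherian.2
    (inferInstanceAs (IsNoetherian Rᵐᵒᵖ M.carrier))
    {L | ∃ (P : RightComodule R C) (f : P ⟶ M), Projective P ∧ Module.Finite Rᵐᵒᵖ P.carrier ∧
      L = LinearMap.range (Hom.toLin f)}
    ⟨_, _, ι hC (isSubcomodule_bot hC M), projective_ofSubcomodule_bot hC M,
      inferInstanceAs (Module.Finite Rᵐᵒᵖ (⊥ : Submodule Rᵐᵒᵖ M.carrier)), rfl⟩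
  refine ⟨P, f, hP, hfin, LinearMap.range_eq_top.1 ?_⟩
  by_contra hne
  obtain ⟨L, hL, hle, hne', hsimple⟩ := exists_simple_quotient hC (isSubcomodule_range hC f) hne
  obtain ⟨Q, q, hq, hQ⟩ := h _ hsimple
  have := hq.projective
  have := hq.epi
  have := hQ.finite hC
  have := epi_of_surjective (π_surjective hL)
  let k := Projective.factorThru q (π hL)
  have hk : k ≫ π hL = q := Projective.factorThru_comp _ _
  let c : P ⨿ Q ⟶ M := Limits.coprod.desc f k
  have hf : LinearMap.range (Hom.toLin f) ≤ LinearMap.range (Hom.toLin c) := by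
    rw [← Limits.coprod.inl_desc f k]
    exact LinearMap.range_comp_le_range _ _
  have hk' : LinearMap.range (Hom.toLin k) ≤ LinearMap.range (Hom.toLin c) := by
    nth_rw 1 [← Limits.coprod.inr_desc f k]
    exact LinearMap.range_comp_le_range _ _
  refine hmax _ ⟨P ⨿ Q, c, inferInstance, finite_coprod hC P Q, rfl⟩
    (lt_of_le_of_ne hf fun heq => hne' ?_)
  refine Submodule.eq_top_iff'.2 fun m => ?_
  obtain ⟨x, hx⟩ := surjective_of_epi hC q (Hom.toLin (π hL) m)
  have hkx : Hom.toLin (π hL) (Hom.toLin k x) = Hom.toLin (π hL) m := by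
    rw [← hx, ← hk]
    rfl
  have hmem : Hom.toLin k x ∈ L := hle (heq ▸ hk' ⟨x, rfl⟩)
  exact (Submodule.Quotient.mk_eq_zero L).1
    (hkx.symm.trans ((Submodule.Quotient.mk_eq_zero L).2 hmem))

theorem enoughProjectives_of_simple (hC : LeftAlphaCondition R C) [IsArtinianRing Rᵐᵒᵖ]
    (h : ∀ S : RightComodule R C, Simple S → S.HasFGProjectiveCover) :
    EnoughProjectives (RightComodule R C) where
  presentation M := by
    choose L hL hfg hmem using fun m : M.carrier => exists_fg_isSubcomodule hC M {m}
    have hfin (m) : Module.Finite Rᵐᵒᵖ (ofSubcomodule hC (hL m)).carrier :=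
      Module.Finite.iff_fg.2 (hfg m)
    choose P f hP _ hf using fun m =>
      exists_finite_projective_surjective hC h (ofSubcomodule hC (hL m))
    refine ⟨{ p := ∐ P, f := Limits.Sigma.desc fun m => f m ≫ ι hC (hL m),
              epi := epi_of_surjective fun m => ?_ }⟩
    obtain ⟨p, hp⟩ := hf m ⟨m, hmem m (by simp)⟩
    have hd := Limits.Sigma.ι_desc (fun m => f m ≫ ι hC (hL m)) m
    exact ⟨Hom.toLin (Limits.Sigma.ι P m) p,
      (LinearMap.congr_fun (congrArg Hom.toLin hd) p).trans (congrArg Subtype.val hp)⟩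

/-! ### Projective generators -/

/-- The coactions on the quotient modules of the left dual `*C`. This is a small type, and every
comodule generated by one element is isomorphic to one of the comodules it indexes. -/
structure CyclicData (R C : Type u) [Ring R] [AddCommGroup C] [Module R C] [Module Rᵐᵒᵖ C]
    [SMulCommClass R Rᵐᵒᵖ C] [Coring R C] : Type u where
  /-- The submodule of `*C` by which the quotient is taken. -/
  ker : Submodule Rᵐᵒᵖ (C →ₗ[R] R)
  /-- The coaction on the quotient. -/
  coact : ((C →ₗ[R] R) ⧸ ker) →ₗ[Rᵐᵒᵖ] BalTensor R ((C →ₗ[R] R) ⧸ ker) C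
  coassoc : ∀ m : (C →ₗ[R] R) ⧸ ker,
    BalTensor.assoc (BalTensor.map coact LinearMap.id (coact m)) =
      BalTensor.map LinearMap.id (Coring.comul (R := R) (C := C)) (coact m)
  counit : ∀ m : (C →ₗ[R] R) ⧸ ker,
    BalTensor.rid (BalTensor.map LinearMap.id (Coring.counit (R := R) (C := C)) (coact m)) = m

/-- The comodule described by a coaction on a quotient of `*C`. -/
def CyclicData.toComodule (D : CyclicData R C) : RightComodule R C where
  carrier := (C →ₗ[R] R) ⧸ D.ker
  coact := D.coact
  coassoc := D.coassoc
  counit := D.counit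

/-- Every element `m` of a comodule is in the image of a comodule from the small family, since
`m · *C` is a quotient of `*C`. -/
theorem CyclicData.exists_hom (hC : LeftAlphaCondition R C) (M : RightComodule R C)
    (m : M.carrier) :
    ∃ (D : CyclicData R C) (φ : D.toComodule ⟶ M), m ∈ LinearMap.range (Hom.toLin φ) := by
  have hL := isSubcomodule_range_act hC M m
  let N := ofSubcomodule hC hL
  let e : ((C →ₗ[R] R) ⧸ LinearMap.ker (M.act m)) ≃ₗ[Rᵐᵒᵖ] N.carrier :=
    (M.act m).quotKerEquivRange
  have h₁ : e.toLinearMap ∘ₗ e.symm.toLinearMap = LinearMap.id := LinearMap.ext e.apply_symm_apply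
  -- The coaction of `m · *C`, transported along `e`.
  let ρ := BalTensor.rTensor C e.symm.toLinearMap ∘ₗ N.coact ∘ₗ e.toLinearMap
  have hρ : ρ ∘ₗ e.symm.toLinearMap = BalTensor.rTensor C e.symm.toLinearMap ∘ₗ N.coact := by
    rw [LinearMap.comp_assoc, LinearMap.comp_assoc, h₁, LinearMap.comp_id]
  have hρ' (x) : ρ x = BalTensor.map e.symm.toLinearMap LinearMap.id (N.coact (e x)) := rfl
  let D : CyclicData R C :=
    { ker := LinearMap.ker (M.act m)
      coact := ρ
      coassoc := fun x => by
        rw [hρ', BalTensor.map_map, hρ, BalTensor.map_map]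
        have := congrArg (BalTensor.map e.symm.toLinearMap LinearMap.id) (N.coassoc (e x))
        rw [← BalTensor.assoc_naturality, BalTensor.map_map, BalTensor.map_map] at this
        exact this
      counit := fun x => by
        rw [hρ', BalTensor.map_map]
        have := congrArg e.symm.toLinearMap (N.counit (e x))
        rw [← BalTensor.rid_naturality, BalTensor.map_map] at this
        exact this.trans (e.symm_apply_apply x) }
  let φ : D.toComodule ⟶ N := Hom.mk e.toLinearMap fun x => by
    refine .trans ?_ (BalTensor.map_map e.symm.toLinearMap e.toLinearMap LinearMap.id LinearMap.id
      (N.coact (e x))).symm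
    rw [h₁]
    exact (BalTensor.map_id_id _).symm
  refine ⟨D, φ ≫ ι hC hL, e.symm ⟨m, Coring.counit, M.act_counit m⟩, ?_⟩
  exact congrArg Subtype.val (e.apply_symm_apply ⟨m, Coring.counit, M.act_counit m⟩)

theorem exists_projective_isSeparator (hC : LeftAlphaCondition R C)
    [EnoughProjectives (RightComodule R C)] :
    ∃ G : RightComodule R C, Projective G ∧ IsSeparator G := by
  refine ⟨∐ fun D : CyclicData R C => Projective.over D.toComodule, inferInstance, ?_⟩
  rw [isSeparator_sigma]
  intro M N g h hgh
  refine hom_ext fun m => ?_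
  obtain ⟨D, φ, x, rfl⟩ := CyclicData.exists_hom hC M m
  have := hgh _ (.mk D) (Projective.π D.toComodule ≫ φ)
  rw [Category.assoc, Category.assoc, cancel_epi] at this
  exact LinearMap.congr_fun (congrArg Hom.toLin this) x

theorem enoughProjectives_of_isSeparator {G : RightComodule R C} [Projective G]
    (hG : IsSeparator G) : EnoughProjectives (RightComodule R C) where
  presentation M := ⟨{
    p := ∐ fun _ : G ⟶ M => G
    f := Limits.Sigma.desc fun f => f
    epi := (isSeparator_iff_epi G).1 hG M }⟩

end RightComodule

theorem theorem3p1 (R C : Type u) [Ring R] [AddCommGroup C] [Module R C] [Module Rᵐᵒᵖ C]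
    [SMulCommClass R Rᵐᵒᵖ C] [Coring R C]
    (hR : IsArtinian Rᵐᵒᵖ R) (hC : LeftAlphaCondition R C) :
    List.TFAE
      [ Coring.IsRightSemiperfect R C,
        ∀ M : RightComodule R C, M.FinitelyGenerated → M.HasProjectiveCover,
        ∀ M : RightComodule R C, M.FinitelyGenerated → M.HasFGProjectiveCover,
        EnoughProjectives (RightComodule R C),
        ∀ S : RightComodule R C, Simple S → S.HasFGProjectiveCover,
        ∃ G : RightComodule R C, Projective G ∧ IsSeparator G ] := by
  have : IsArtinianRing Rᵐᵒᵖ :=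
    isArtinian_of_linearEquiv (MulOpposite.opLinearEquiv Rᵐᵒᵖ : R ≃ₗ[Rᵐᵒᵖ] Rᵐᵒᵖ)
  tfae_have 1 → 5 := fun h S hS => (h S hS).fg hC (RightComodule.finitelyGenerated_of_simple hC S)
  tfae_have 5 → 3 := fun h M hM => by
    have := hM.finite hC
    obtain ⟨P, f, hP, hfin, hf⟩ := RightComodule.exists_finite_projective_surjective hC h M
    exact RightComodule.hasFGProjectiveCover_of_surjective hC f hf
  tfae_have 3 → 2 := fun h M hM => by
    obtain ⟨P, f, hf, -⟩ := h M hM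
    exact ⟨P, f, hf⟩
  tfae_have 2 → 1 := fun h S hS => h S (RightComodule.finitelyGenerated_of_simple hC S)
  tfae_have 5 → 4 := RightComodule.enoughProjectives_of_simple hC
  tfae_have 4 → 5 := fun _ S hS => by
    refine RightComodule.hasFGProjectiveCover_of_simple hC (f := Projective.π S)
      fun h0 => id_nonzero S ?_
    rw [← cancel_epi (Projective.π S), h0, Limits.zero_comp, Limits.zero_comp]
  tfae_have 4 → 6 := fun _ => RightComodule.exists_projective_isSeparator hC
  tfae_have 6 → 4 := fun ⟨_, _, hG⟩ => RightComodule.enoughProjectives_of_isSeparator hG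
  tfae_finish
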